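/- For $x=(\phi_1,\phi_2,\theta_2,\phi_3,\theta_3,\phi_4,\theta_4)\in\mathbb R^7$ let $P(\phi,\theta)=(\cos\phi\cos\theta,\cos\phi\sin\theta,\sin\phi)\in S^2$ and let $f(x)$ be the sum of the ten mutual Euclidean distances of the five points $A=P(0,0)$, $B=P(\phi_1,\pi)$, $C=P(\phi_2,\theta_2)$, $D=P(\phi_3,\theta_3)$, $E=P(\phi_4,\theta_4)$. Let $\Theta_{bp}=(-\frac\pi3,\frac\pi3,\pi,0,-\frac\pi2,0,\frac\pi2)$ (a bipyramid configuration) and $fmax=f(\Theta_{bp})$. Put $s=-\frac34+\frac{\sqrt2}2+\frac{\sqrt{41-28\sqrt2}}4$, $\omega_1=\arcsin s$, $\omega_2=-\arcsin(s\sqrt{1-s^2})$, $\omega_3=\operatorname{arccot}\bigl(s^2/\sqrt{1-s^2}\bigr)\in(0,\pi)$, and let $\Theta_p=(-2\omega_1,\frac\pi2-\omega_1,\pi,\omega_2,-\omega_3,\omega_2,\omega_3)$ (a square-pyramid configuration). Let $\mathcal D_p\subset\mathbb R^7$ be the closed box $\phi_1\in\left[-\tfrac{5157880419}{10000000000},\,-\tfrac{203137879}{400000000}\right]$,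 $\phi_2\in\left[\tfrac{1310916469}{1000000000},\,\tfrac{263771963}{200000000}\right]$, $\theta_2\in\left[\tfrac{156881049}{50000000},\,\tfrac{3145564327}{1000000000}\right]$, $\phi_3\in\left[-\tfrac{39276321}{156250000},\,-\tfrac{2434251099}{10000000000}\right]$, $\theta_3\in\left[-\tfrac{1508635943}{1000000000},\,-\tfrac{375173149}{250000000}\right]$, $\phi_4\in\left[-\tfrac{39276321}{156250000},\,-\tfrac{2434251099}{10000000000}\right]$, $\theta_4\in\left[\tfrac{375173149}{250000000},\,\tfrac{1508635943}{1000000000}\right]$. Let $\mathcal W=[\underline W,\overline W]$ be the set of all symmetric real $7\times7$ matrices whose $(i,j)$ and $(j,i)$ entries lie in the interval $\mathcal W_{ij}$, $i\le j$, where $\mathcal W_{11}=\left[-\tfrac{68555671}{80000000},\,-\tfrac{8085653887}{10000000000}\right]$, $\mathcal W_{12}=\left[\tfrac{241020403}{625000000},\,\tfrac{4060471777}{10000000000}\right]$, $\mathcal W_{13}=\left[-\tfrac{5396514777}{10000000000000},\,\tfrac{5396514777}{10000000000000}\right]$, $\mathcal W_{14}=\left[-\tfrac{665453073}{1000000000},\,-\tfrac{3261193771}{5000000000}\right]$,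 $\mathcal W_{15}=\left[\tfrac{323160259}{1250000000},\,\tfrac{2727361243}{10000000000}\right]$, $\mathcal W_{16}=\left[-\tfrac{6654530721}{10000000000},\,-\tfrac{6522387553}{10000000000}\right]$, $\mathcal W_{17}=\left[-\tfrac{545472247}{2000000000},\,-\tfrac{16158013}{62500000}\right]$, $\mathcal W_{22}=\left[-\tfrac{567279649}{500000000},\,-\tfrac{544204613}{500000000}\right]$, $\mathcal W_{23}=\left[-\tfrac{609173849}{50000000000},\,\tfrac{1218347717}{100000000000}\right]$, $\mathcal W_{24}=\left[-\tfrac{68583739}{400000000},\,-\tfrac{1584190467}{10000000000}\right]$, $\mathcal W_{25}=\left[-\tfrac{1486861643}{2500000000},\,-\tfrac{5875949419}{10000000000}\right]$, $\mathcal W_{26}=\left[-\tfrac{428648367}{2500000000},\,-\tfrac{792095233}{5000000000}\right]$, $\mathcal W_{27}=\left[\tfrac{2937974709}{5000000000},\,\tfrac{5947446571}{10000000000}\right]$, $\mathcal W_{33}=\left[-\tfrac{8085854539}{100000000000},\,-\tfrac{1541389841}{25000000000}\right]$, $\mathcal W_{34}=\left[-\tfrac{9959577971}{100000000000},\,-\tfrac{9385595363}{100000000000}\right]$,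 $\mathcal W_{35}=\left[\tfrac{116759761}{5000000000},\,\tfrac{109700733}{4000000000}\right]$, $\mathcal W_{36}=\left[\tfrac{9385595361}{100000000000},\,\tfrac{9959577971}{100000000000}\right]$, $\mathcal W_{37}=\left[\tfrac{2335195223}{100000000000},\,\tfrac{2742518293}{100000000000}\right]$, $\mathcal W_{44}=\left[-\tfrac{8828398133}{10000000000},\,-\tfrac{1678302277}{2000000000}\right]$, $\mathcal W_{45}=\left[-\tfrac{585736263}{5000000000},\,-\tfrac{2143830967}{25000000000}\right]$, $\mathcal W_{46}=\left[-\tfrac{4897161727}{10000000000},\,-\tfrac{4822526949}{10000000000}\right]$, $\mathcal W_{47}=\left[\tfrac{616963279}{100000000000},\,\tfrac{1002395789}{100000000000}\right]$, $\mathcal W_{55}=\left[-\tfrac{36387877}{31250000},\,-\tfrac{225679327}{200000000}\right]$, $\mathcal W_{56}=\left[-\tfrac{1002395789}{100000000000},\,-\tfrac{616963279}{100000000000}\right]$, $\mathcal W_{57}=\left[\tfrac{4813603601}{10000000000},\,\tfrac{1215175283}{2500000000}\right]$, $\mathcal W_{66}=\left[-\tfrac{8828398113}{10000000000},\,-\tfrac{4195755701}{5000000000}\right]$,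 $\mathcal W_{67}=\left[\tfrac{171506479}{2000000000},\,\tfrac{1171472521}{10000000000}\right]$, $\mathcal W_{77}=\left[-\tfrac{582206031}{500000000},\,-\tfrac{564198319}{500000000}\right]$. Let $W_c=\frac12(\underline W+\overline W)$ and $W_\delta=\frac12(\overline W-\underline W)$ be the matrices of midpoints and of radii, let $\lambda_1(\cdot)$ be the largest eigenvalue and $\varrho(\cdot)$ the largest modulus of an eigenvalue of a symmetric matrix. Then: 1. $fmax=3\sqrt3+6\sqrt2+2$. 2. $\{x:\|x-\Theta_p\|_\infty\le\frac\pi{791}\}\subseteq\mathcal D_p\subseteq\{x:\|x-\Theta_p\|_\infty\le\frac\pi{791}+10^{-8}\}$. 3. $f$ is $C^2$ near every point of $\mathcal D_p$, $\nabla f(\Theta_p)=0$, and $|f(\Theta_p)-15.67482117|\le10^{-8}$. 4. For every $x\in\mathcal D_p$ the Hessian matrix of $f$ at $x$ belongs to $\mathcal W$. 5. $\lambda_1(W_c)-\varrho(W_\delta)>0$, and no matrix in $\mathcal W$ is negative semidefinite. 6. No point of $\mathcal D_p$ is a local maximum point of $f$ (as a function on $\mathbb R^7$), and $f(x)<fmax$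 for every $x\in\mathcal D_p$. -/

import Mathlib

open scoped Matrix

noncomputable section

namespace FivePoints

/-- The point of the unit sphere with latitude `φ` and longitude `θ`. -/
def sphPoint (φ θ : ℝ) : EuclideanSpace ℝ (Fin 3) :=
  !₂[Real.cos φ * Real.cos θ, Real.cos φ * Real.sin θ, Real.sin φ]

/-- The five points `A, B, C, D, E` with coordinates
`x = (φ₁, φ₂, θ₂, φ₃, θ₃, φ₄, θ₄)`. -/
def points (x : Fin 7 → ℝ) : Fin 5 → EuclideanSpace ℝ (Fin 3) :=
  ![sphPoint 0 0, sphPoint (x 0) Real.pi, sphPoint (x 1) (x 2), sphPoint (x 3) (x 4),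
    sphPoint (x 5) (x 6)]

/-- The sum of the ten mutual distances of the five points. -/
def f (x : Fin 7 → ℝ) : ℝ :=
  ∑ i : Fin 5, ∑ j ∈ Finset.Ioi i, dist (points x i) (points x j)

/-- The coordinates of the bipyramid configuration. -/
def thetaBP : Fin 7 → ℝ :=
  ![-(Real.pi / 3), Real.pi / 3, Real.pi, 0, -(Real.pi / 2), 0, Real.pi / 2]

/-- The value of `f` at the bipyramid configuration. -/
def fmax : ℝ := f thetaBP

/-- The sine of `ω₁`. -/
def sinOmega1 : ℝ := -(3 / 4) + √2 / 2 + √(41 - 28 * √2) / 4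

def omega1 : ℝ := Real.arcsin sinOmega1

def omega2 : ℝ := -Real.arcsin (sinOmega1 * √(1 - sinOmega1 ^ 2))

/-- The inverse cotangent with values in `(0, π)`. -/
def arccot (x : ℝ) : ℝ := Real.pi / 2 - Real.arctan x

def omega3 : ℝ := arccot (sinOmega1 ^ 2 / √(1 - sinOmega1 ^ 2))

/-- The coordinates of the pyramid configuration. -/
def thetaP : Fin 7 → ℝ :=
  ![-2 * omega1, Real.pi / 2 - omega1, Real.pi, omega2, -omega3, omega2, omega3]

/-- Lower endpoints of the box around the pyramid configuration. -/
def boxLower : Fin 7 → ℝ :=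
  ![-5157880419 / 10000000000,
    1310916469 / 1000000000,
    156881049 / 50000000,
    -39276321 / 156250000,
    -1508635943 / 1000000000,
    -39276321 / 156250000,
    375173149 / 250000000]

/-- Upper endpoints of the box around the pyramid configuration. -/
def boxUpper : Fin 7 → ℝ :=
  ![-203137879 / 400000000,
    263771963 / 200000000,
    3145564327 / 1000000000,
    -2434251099 / 10000000000,
    -375173149 / 250000000,
    -2434251099 / 10000000000,
    1508635943 / 1000000000]

/-- The box around the pyramid configuration. -/
def boxP : Set (Fin 7 → ℝ) := Set.Icc boxLower boxUpper

/-- The matrix of second partial derivatives. -/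
def hessian (g : (Fin 7 → ℝ) → ℝ) (x : Fin 7 → ℝ) : Matrix (Fin 7) (Fin 7) ℝ :=
  Matrix.of fun i j => fderiv ℝ (fderiv ℝ g) x (Pi.single i 1) (Pi.single j 1)

/-- The symmetric interval matrix `[L, U]`: all symmetric real matrices lying entrywise
between `L` and `U`. -/
def symIntervalMatrix {n : ℕ} (L U : Matrix (Fin n) (Fin n) ℝ) :
    Set (Matrix (Fin n) (Fin n) ℝ) :=
  {A | A.IsSymm ∧ ∀ i j, L i j ≤ A i j ∧ A i j ≤ U i j}

/-- The midpoint matrix of `[L, U]`. -/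
def midMatrix {n : ℕ} (L U : Matrix (Fin n) (Fin n) ℝ) : Matrix (Fin n) (Fin n) ℝ :=
  (1 / 2 : ℝ) • (L + U)

/-- The radius matrix of `[L, U]`. -/
def radMatrix {n : ℕ} (L U : Matrix (Fin n) (Fin n) ℝ) : Matrix (Fin n) (Fin n) ℝ :=
  (1 / 2 : ℝ) • (U - L)

/-- The largest eigenvalue (of a real symmetric matrix). -/
def maxEigenvalue {n : ℕ} (A : Matrix (Fin n) (Fin n) ℝ) : ℝ := sSup (spectrum ℝ A)

/-- The maximal modulus of the eigenvalues (of a real symmetric matrix). -/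
def maxEigenvalueModulus {n : ℕ} (A : Matrix (Fin n) (Fin n) ℝ) : ℝ :=
  sSup ((fun l : ℝ => |l|) '' spectrum ℝ A)

/-- Lower endpoints of the interval Hessian matrix over the box. -/
def hessLower : Matrix (Fin 7) (Fin 7) ℝ :=
  !![-68555671 / 80000000, 241020403 / 625000000, -5396514777 / 10000000000000, -665453073 / 1000000000, 323160259 / 1250000000, -6654530721 / 10000000000, -545472247 / 2000000000;
    241020403 / 625000000, -567279649 / 500000000, -609173849 / 50000000000, -68583739 / 400000000, -1486861643 / 2500000000, -428648367 / 2500000000, 2937974709 / 5000000000;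
    -5396514777 / 10000000000000, -609173849 / 50000000000, -8085854539 / 100000000000, -9959577971 / 100000000000, 116759761 / 5000000000, 9385595361 / 100000000000, 2335195223 / 100000000000;
    -665453073 / 1000000000, -68583739 / 400000000, -9959577971 / 100000000000, -8828398133 / 10000000000, -585736263 / 5000000000, -4897161727 / 10000000000, 616963279 / 100000000000;
    323160259 / 1250000000, -1486861643 / 2500000000, 116759761 / 5000000000, -585736263 / 5000000000, -36387877 / 31250000, -1002395789 / 100000000000, 4813603601 / 10000000000;
    -6654530721 / 10000000000, -428648367 / 2500000000, 9385595361 / 100000000000, -4897161727 / 10000000000, -1002395789 / 100000000000, -8828398113 / 10000000000, 171506479 / 2000000000;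
    -545472247 / 2000000000, 2937974709 / 5000000000, 2335195223 / 100000000000, 616963279 / 100000000000, 4813603601 / 10000000000, 171506479 / 2000000000, -582206031 / 500000000]

/-- Upper endpoints of the interval Hessian matrix over the box. -/
def hessUpper : Matrix (Fin 7) (Fin 7) ℝ :=
  !![-8085653887 / 10000000000, 4060471777 / 10000000000, 5396514777 / 10000000000000, -3261193771 / 5000000000, 2727361243 / 10000000000, -6522387553 / 10000000000, -16158013 / 62500000;
    4060471777 / 10000000000, -544204613 / 500000000, 1218347717 / 100000000000, -1584190467 / 10000000000, -5875949419 / 10000000000, -792095233 / 5000000000, 5947446571 / 10000000000;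
    5396514777 / 10000000000000, 1218347717 / 100000000000, -1541389841 / 25000000000, -9385595363 / 100000000000, 109700733 / 4000000000, 9959577971 / 100000000000, 2742518293 / 100000000000;
    -3261193771 / 5000000000, -1584190467 / 10000000000, -9385595363 / 100000000000, -1678302277 / 2000000000, -2143830967 / 25000000000, -4822526949 / 10000000000, 1002395789 / 100000000000;
    2727361243 / 10000000000, -5875949419 / 10000000000, 109700733 / 4000000000, -2143830967 / 25000000000, -225679327 / 200000000, -616963279 / 100000000000, 1215175283 / 2500000000;
    -6522387553 / 10000000000, -792095233 / 5000000000, 9959577971 / 100000000000, -4822526949 / 10000000000, -616963279 / 100000000000, -4195755701 / 5000000000, 1171472521 / 10000000000;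
    -16158013 / 62500000, 5947446571 / 10000000000, 2742518293 / 100000000000, 1002395789 / 100000000000, 1215175283 / 2500000000, 1171472521 / 10000000000, -564198319 / 500000000]

end FivePoints

end

/-!
The ten distances are functions `√(2 - 2u)` of the inner products `u` of the five points, and `u`
is a trigonometric polynomial in at most four of the seven coordinates. Away from coincident points
`f` is therefore smooth, with explicit first and second derivatives (`Separated.fderiv_f`,
`Separated.fderiv_fderiv_f`).

The claims about the whole box are proved by affine arithmetic. Every quantity is enclosed in a form
`mid + ∑ linₙ δₙ ± err`, where the noise variables `δₙ ∈ [-1, 1]` are the coordinates relative to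
the box, so that first-order dependencies between terms are kept and only quadratic ones are lost.
This is sharp enough to evaluate each Hessian entry on the box without subdividing it. The
forms have integer coefficients, in units of `10⁻¹³`; their arithmetic is proved sound in
`Encloses.mul`, `Encloses.rsqrt` and `encloses_sinForm`, and the resulting inequalities between
integers (`hessForm_bounds`, `rsqrtValid_sqDist`, `upper_sumForm_le`) are decided by computation.
The same computation shows that the points stay distinct on the box and that `f ≤ 15.68` there, which is
below the value of `f` at the bipyramid.

For the interval matrix, the Rayleigh quotient of the midpoint matrix at an explicit vector bounds
its largest eigenvalue from below, and a Collatz–Wielandt estimate bounds the spectral radius of the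
radius matrix from above (`lt_maxEigenvalue_mid`, `maxEigenvalueModulus_rad_le`). Along the same
vector every matrix of the interval is positive, so the second derivative of `f` in this
direction is positive on the box, and there is no local maximum there.

At the pyramid point all sines and cosines are rational functions of the sine and cosine of
`omega1` and of the cosine of `omega2`. Symmetry leaves a single condition for a vanishing gradient,
the quadratic equation `sinOmega1_eq`; it expresses the length of the edges at the apex
through that of the edges of the base. The point is located numerically by Taylor bounds for
the sine at the endpoints of small intervals.
-/

namespace FivePoints

/-! ### Affine arithmetic -/

/-- The fixed-point scale: an integer `n` stands for the real number `n / scale`. At this scale the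
centre and the radii of the box and the bounds on the Hessian entries are all integers. -/
def scale : ℤ := 10000000000000

/-- An affine form `mid + ∑ linₙ δₙ ± err` in noise variables `δₙ ∈ [-1, 1]`; the integers `mid`,
`linₙ`, `err` are understood in units of `1 / scale`. -/
structure AffineForm where
  mid : ℤ
  lin : List ℤ
  err : ℤ

namespace AffineForm

/-- The value `∑ lₙ δₙ` of a list of coefficients at the noise variables `δ`. -/
noncomputable def linEval : List ℤ → (ℕ → ℝ) → ℝ
  | [], _ => 0
  | a :: l, δ => a * δ 0 + linEval l (fun n => δ (n + 1))

/-- Sum of two coefficient lists, the shorter one being padded with zeros. -/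
def addLin : List ℤ → List ℤ → List ℤ
  | [], l => l
  | a :: l, [] => a :: l
  | a :: l, b :: m => (a + b) :: addLin l m

/-- The sum of the absolute values of the coefficients. -/
def size : List ℤ → ℤ
  | [] => 0
  | a :: l => (a.natAbs : ℤ) + size l

/-- The form `a` encloses the real number `v` at the noise variables `δ`. -/
def Encloses (δ : ℕ → ℝ) (a : AffineForm) (v : ℝ) : Prop :=
  |v * scale - (a.mid + linEval a.lin δ)| ≤ a.err

/-- The exact form of the fixed-point number `k / scale`. -/
def const (k : ℤ) : AffineForm := ⟨k, [], 0⟩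

def add (a b : AffineForm) : AffineForm := ⟨a.mid + b.mid, addLin a.lin b.lin, a.err + b.err⟩

/-- Multiplication by an integer, without rounding. The case `n = 0` is split off so that the form
`a` need not be evaluated there. -/
def smul (n : ℤ) (a : AffineForm) : AffineForm :=
  if n = 0 then const 0 else ⟨n * a.mid, a.lin.map (n * ·), n.natAbs * a.err⟩

/-- Negation goes through `smul`, so that the form `const 0` stays free of coefficients. -/
def neg (a : AffineForm) : AffineForm := smul (-1) a

def sub (a b : AffineForm) : AffineForm := add a (neg b)

/-- Product: the bilinear part of the noise goes into the error, and all coefficients are rounded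
down to multiples of `1 / scale`. Each rounding, including that of the error itself, costs at most
one unit, whence the term `2 + l.length`. -/
def mul (a b : AffineForm) : AffineForm :=
  let l := addLin (b.lin.map (a.mid * ·)) (a.lin.map (b.mid * ·))
  ⟨a.mid * b.mid / scale, l.map (· / scale),
    (size a.lin * size b.lin + a.err * (b.mid.natAbs + size b.lin + b.err)
      + b.err * (a.mid.natAbs + size a.lin)) / scale + 2 + l.length⟩

/-- Upper bound of the form over all noise variables. -/
def upper (a : AffineForm) : ℤ := a.mid + size a.lin + a.err

/-- Lower bound of the form over all noise variables. -/
def lower (a : AffineForm) : ℤ := a.mid - size a.lin - a.err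

/-- The form with its error increased by `e`. -/
def enlarge (e : ℤ) (a : AffineForm) : AffineForm := ⟨a.mid, a.lin, a.err + e⟩

/-- `h² y`, where `h / scale` approximates `1 / √y`; it is close to `1`. -/
def rsqrtArg (h : ℤ) (y : AffineForm) : AffineForm := mul (mul (const h) (const h)) y

/-- A bound for `|h² y - 1|`. -/
def rsqrtDev (h : ℤ) (y : AffineForm) : ℤ :=
  ((rsqrtArg h y).mid - scale).natAbs + size (rsqrtArg h y).lin + (rsqrtArg h y).err

/-- Condition on the approximation `h / scale` of `1 / √y` under which `rsqrt h y` is valid. -/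
def RsqrtValid (h : ℤ) (y : AffineForm) : Prop := 0 < h ∧ 5 * rsqrtDev h y ≤ scale

instance (h : ℤ) (y : AffineForm) : Decidable (RsqrtValid h y) :=
  inferInstanceAs (Decidable (_ ∧ _))

/-- The reciprocal square root: with `z = h² y` near `1`, the tangent `(3 - z) / 2` approximates
`1 / √z` up to `(z - 1)² / 2`, and `1 / √y = h / √z`. -/
def rsqrt (h : ℤ) (y : AffineForm) : AffineForm :=
  mul (const h) (enlarge (rsqrtDev h y * rsqrtDev h y / (2 * scale) + 1)
    (mul (const (scale / 2)) (sub (const (3 * scale)) (rsqrtArg h y))))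

/-- The sum of a family of forms along a list. -/
def listSum {ι : Type*} (F : ι → AffineForm) : List ι → AffineForm
  | [] => const 0
  | i :: l => add (F i) (listSum F l)

/-! ### Soundness of affine arithmetic -/

lemma linEval_addLin (l m : List ℤ) (δ : ℕ → ℝ) :
    linEval (addLin l m) δ = linEval l δ + linEval m δ := by
  induction l generalizing m δ with
  | nil => simp [addLin, linEval]
  | cons a l ih =>
    cases m with
    | nil => simp [addLin, linEval]
    | cons b m => simp only [addLin, linEval, ih]; push_cast; ring

lemma linEval_map_mul (n : ℤ) (l : List ℤ) (δ : ℕ → ℝ) :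
    linEval (l.map (n * ·)) δ = n * linEval l δ := by
  induction l generalizing δ with
  | nil => simp [linEval]
  | cons a l ih => simp only [List.map_cons, linEval, ih]; push_cast; ring

lemma size_nonneg (l : List ℤ) : 0 ≤ size l := by
  induction l with
  | nil => simp [size]
  | cons a l ih => simp only [size]; positivity

lemma abs_linEval_le (l : List ℤ) {δ : ℕ → ℝ} (hδ : ∀ n, |δ n| ≤ 1) :
    |linEval l δ| ≤ size l := by
  induction l generalizing δ with
  | nil => simp [linEval, size]
  | cons a l ih =>
    simp only [linEval, size]
    push_cast
    have h1 : |(a : ℝ) * δ 0| ≤ |(a : ℝ)| := by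
      rw [abs_mul]; exact mul_le_of_le_one_right (abs_nonneg _) (hδ 0)
    have h2 := ih (δ := fun n => δ (n + 1)) fun n => hδ _
    exact (abs_add_le _ _).trans (by linarith)

/-- Rounding down to an integer changes a number by at most one. -/
lemma abs_div_scale_sub_le (n : ℤ) : |(n : ℝ) / scale - (n / scale : ℤ)| ≤ 1 := by
  have h : (0 : ℝ) < scale := by norm_num [scale]
  have h1 := Int.emod_add_mul_ediv n scale
  have h2 := Int.emod_nonneg n (show scale ≠ 0 by decide)
  have h3 := Int.emod_lt_of_pos n (show 0 < scale by decide)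
  have h1' : (n : ℝ) = (n % scale : ℤ) + scale * (n / scale : ℤ) := by exact_mod_cast h1.symm
  have h2' : (0 : ℝ) ≤ (n % scale : ℤ) := by exact_mod_cast h2
  have h3' : ((n % scale : ℤ) : ℝ) ≤ scale := by exact_mod_cast h3.le
  have : (n : ℝ) / scale - (n / scale : ℤ) = (n % scale : ℤ) / scale := by
    rw [eq_div_iff h.ne', sub_mul, div_mul_cancel₀ _ h.ne']; linarith
  rw [this, abs_of_nonneg (by positivity)]
  exact (div_le_one h).2 h3'

lemma abs_linEval_round_le (l : List ℤ) {δ : ℕ → ℝ} (hδ : ∀ n, |δ n| ≤ 1) :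
    |linEval l δ / scale - linEval (l.map (· / scale)) δ| ≤ l.length := by
  induction l generalizing δ with
  | nil => simp [linEval]
  | cons a l ih =>
    simp only [List.map_cons, linEval, List.length_cons]
    have h2 := ih (δ := fun n => δ (n + 1)) fun n => hδ _
    have h1 : |((a : ℝ) / scale - (a / scale : ℤ)) * δ 0| ≤ 1 := by
      rw [abs_mul]
      exact mul_le_one₀ (abs_div_scale_sub_le a) (abs_nonneg _) (hδ 0)
    have h3 := (abs_add_le _ _).trans (add_le_add h1 h2)
    rw [show (a * δ 0 + linEval l fun n => δ (n + 1)) / (scale : ℝ)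
        - ((a / scale : ℤ) * δ 0 + linEval (l.map (· / scale)) fun n => δ (n + 1))
        = ((a : ℝ) / scale - (a / scale : ℤ)) * δ 0
          + ((linEval l fun n => δ (n + 1)) / scale
            - linEval (l.map (· / scale)) fun n => δ (n + 1)) by ring]
    push_cast
    linarith

lemma scale_pos : (0 : ℝ) < scale := by norm_num [scale]

variable {δ : ℕ → ℝ} {a b y : AffineForm} {v w : ℝ}

lemma Encloses.err_nonneg (h : Encloses δ a v) : (0 : ℝ) ≤ a.err := (abs_nonneg _).trans h

lemma encloses_const (k : ℤ) : Encloses δ (const k) (k / scale) := by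
  simp [Encloses, const, linEval, div_mul_cancel₀ _ scale_pos.ne']

lemma encloses_zero : Encloses δ (const 0) 0 := by
  simpa using encloses_const (δ := δ) 0

lemma encloses_one : Encloses δ (const scale) 1 := by
  simpa [div_self scale_pos.ne'] using encloses_const (δ := δ) scale

lemma Encloses.add (ha : Encloses δ a v) (hb : Encloses δ b w) :
    Encloses δ (add a b) (v + w) := by
  unfold Encloses at *
  simp only [AffineForm.add, linEval_addLin]
  push_cast
  refine le_trans (le_of_eq ?_) ((abs_add_le _ _).trans (add_le_add ha hb))
  congr 1
  ring

lemma Encloses.smul (n : ℤ) (ha : Encloses δ a v) : Encloses δ (smul n a) (n * v) := by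
  unfold AffineForm.smul
  split_ifs with hn
  · simpa [hn] using encloses_zero (δ := δ)
  · unfold Encloses at *
    simp only [linEval_map_mul]
    push_cast
    calc _ = |(n : ℝ)| * |v * scale - (a.mid + linEval a.lin δ)| := by
          rw [← abs_mul]; congr 1; ring
      _ ≤ _ := by gcongr

lemma Encloses.neg (ha : Encloses δ a v) : Encloses δ (neg a) (-v) := by
  have h := ha.smul (-1)
  rwa [Int.cast_neg, Int.cast_one, neg_one_mul] at h

lemma Encloses.sub (ha : Encloses δ a v) (hb : Encloses δ b w) :
    Encloses δ (sub a b) (v - w) := by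
  rw [sub_eq_add_neg]
  exact ha.add hb.neg

lemma Encloses.enlarge {e : ℤ} (ha : Encloses δ a v) (hw : |w - v| * scale ≤ e) :
    Encloses δ (enlarge e a) w := by
  unfold Encloses at *
  have h : |(w - v) * scale| ≤ e := by rwa [abs_mul, abs_of_pos scale_pos]
  simp only [AffineForm.enlarge]
  push_cast
  rw [add_comm (a.err : ℝ)]
  refine le_trans (le_of_eq ?_) ((abs_add_le _ _).trans (add_le_add h ha))
  congr 1
  ring

lemma Encloses.mul (hδ : ∀ n, |δ n| ≤ 1) (ha : Encloses δ a v) (hb : Encloses δ b w) :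
    Encloses δ (mul a b) (v * w) := by
  have hS := scale_pos
  have hea := ha.err_nonneg
  have heb := hb.err_nonneg
  have hla := abs_linEval_le a.lin hδ
  have hlb := abs_linEval_le b.lin hδ
  unfold Encloses at *
  set l := addLin (b.lin.map (a.mid * ·)) (a.lin.map (b.mid * ·)) with hl
  set N : ℤ := size a.lin * size b.lin + a.err * (b.mid.natAbs + size b.lin + b.err)
      + b.err * (a.mid.natAbs + size a.lin) with hN
  have hform : AffineForm.mul a b
      = ⟨a.mid * b.mid / scale, l.map (· / scale), N / scale + 2 + l.length⟩ := rfl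
  have hlv : linEval l δ = a.mid * linEval b.lin δ + b.mid * linEval a.lin δ := by
    rw [hl, linEval_addLin, linEval_map_mul, linEval_map_mul]
  have r1 := abs_div_scale_sub_le (a.mid * b.mid)
  have r2 := abs_linEval_round_le l hδ
  have r3 := abs_div_scale_sub_le N
  rw [hform]
  simp only
  push_cast at r1 ⊢
  set α := v * scale - (a.mid + linEval a.lin δ) with hα
  set β := w * scale - (b.mid + linEval b.lin δ) with hβ
  set A := linEval a.lin δ
  set B := linEval b.lin δ
  have hNr : (N : ℝ) = size a.lin * size b.lin
      + a.err * (|(b.mid : ℝ)| + size b.lin + b.err)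
      + b.err * (|(a.mid : ℝ)| + size a.lin) := by
    rw [hN]; push_cast; rfl
  have hsa : (0 : ℝ) ≤ size a.lin := by exact_mod_cast size_nonneg _
  have main : |A * B + α * (b.mid + B + β) + β * (a.mid + A)| ≤ N := by
    rw [hNr]
    refine (abs_add_three _ _ _).trans ?_
    rw [abs_mul, abs_mul, abs_mul]
    gcongr
    · exact (abs_add_three _ _ _).trans (by gcongr)
    · exact (abs_add_le _ _).trans (by gcongr)
  have main' : |(A * B + α * (b.mid + B + β) + β * (a.mid + A)) / scale| ≤ N / scale := by
    rw [abs_div, abs_of_pos hS]; gcongr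
  have key : v * w * scale - ((a.mid * b.mid / scale : ℤ) + linEval (l.map (· / scale)) δ)
      = ((a.mid : ℝ) * b.mid / scale - (a.mid * b.mid / scale : ℤ))
        + (linEval l δ / scale - linEval (l.map (· / scale)) δ)
        + (A * B + α * (b.mid + B + β) + β * (a.mid + A)) / scale := by
    rw [hlv, hα, hβ]
    field_simp
    ring
  rw [key]
  have h3 := abs_le.1 r3
  refine (abs_add_three _ _ _).trans ?_
  linarith

lemma Encloses.le_upper (hδ : ∀ n, |δ n| ≤ 1) (ha : Encloses δ a v) :
    v ≤ (upper a : ℝ) / scale := by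
  have h1 := abs_le.1 (abs_linEval_le a.lin hδ)
  have h2 := abs_le.1 ha
  rw [le_div_iff₀ scale_pos, upper]
  push_cast
  linarith

lemma Encloses.lower_le (hδ : ∀ n, |δ n| ≤ 1) (ha : Encloses δ a v) :
    (lower a : ℝ) / scale ≤ v := by
  have h1 := abs_le.1 (abs_linEval_le a.lin hδ)
  have h2 := abs_le.1 ha
  rw [div_le_iff₀ scale_pos, lower]
  push_cast
  linarith

/-- The tangent bound for `1 / √z` at `z = 1`. -/
lemma abs_inv_sqrt_sub_le {z : ℝ} (hz : |z - 1| ≤ 1 / 5) :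
    |(√z)⁻¹ - (3 - z) / 2| ≤ (z - 1) ^ 2 / 2 := by
  have hz' := abs_le.1 hz
  have hz0 : 0 < z := by linarith
  set r := √z with hr
  have hr0 : 0 < r := Real.sqrt_pos.2 hz0
  have hzr : z = r ^ 2 := (Real.sq_sqrt hz0.le).symm
  have hr1 : 22 / 25 ≤ r := Real.le_sqrt_of_sq_le (by linarith)
  have e1 : r⁻¹ - (3 - z) / 2 = (r - 1) ^ 2 * (r + 2) / (2 * r) := by
    rw [hzr]; field_simp; ring
  have h0 : 0 ≤ (r - 1) ^ 2 * (r + 2) / (2 * r) := by positivity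
  rw [e1, abs_of_nonneg h0, div_le_iff₀ (by positivity), hzr,
    show (r ^ 2 - 1) ^ 2 / 2 * (2 * r) = (r - 1) ^ 2 * ((r + 1) ^ 2 * r) by ring]
  gcongr
  nlinarith [mul_pos hr0 hr0, mul_nonneg (sub_nonneg.2 hr1) hr0.le]

lemma Encloses.abs_rsqrtArg_le {h : ℤ} (hδ : ∀ n, |δ n| ≤ 1) (hy : Encloses δ y v) :
    |(h / scale : ℝ) ^ 2 * v - 1| ≤ (rsqrtDev h y : ℝ) / scale := by
  have hz : Encloses δ (rsqrtArg h y) ((h / scale : ℝ) ^ 2 * v) := by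
    rw [sq]
    exact ((encloses_const h).mul hδ (encloses_const h)).mul hδ hy
  have hz' := abs_linEval_le (rsqrtArg h y).lin hδ
  unfold Encloses at hz
  rw [le_div_iff₀ scale_pos, ← abs_of_pos scale_pos, ← abs_mul, abs_of_pos scale_pos]
  set z := (h / scale : ℝ) ^ 2 * v
  rw [rsqrtDev]
  push_cast
  calc _ = |((rsqrtArg h y).mid - scale) + linEval (rsqrtArg h y).lin δ
        + (z * scale - ((rsqrtArg h y).mid + linEval (rsqrtArg h y).lin δ))| := by
        congr 1; ring
    _ ≤ _ := (abs_add_three _ _ _).trans (by gcongr)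

/-- A valid hint certifies positivity, since `h² v` is then close to `1`. -/
lemma RsqrtValid.pos {h : ℤ} (hδ : ∀ n, |δ n| ≤ 1) (hv : RsqrtValid h y)
    (hy : Encloses δ y v) : 0 < v := by
  have h1 := hy.abs_rsqrtArg_le (h := h) hδ
  have h2 : (rsqrtDev h y : ℝ) / scale ≤ 1 / 5 := by
    have : (5 * rsqrtDev h y : ℝ) ≤ scale := by exact_mod_cast hv.2
    rw [div_le_div_iff₀ scale_pos (by norm_num)]; linarith
  have h3 := abs_le.1 (h1.trans h2)
  by_contra hneg
  have : (h / scale : ℝ) ^ 2 * v ≤ 0 :=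
    mul_nonpos_of_nonneg_of_nonpos (sq_nonneg _) (not_lt.1 hneg)
  linarith

lemma Encloses.rsqrt {h : ℤ} (hδ : ∀ n, |δ n| ≤ 1) (hv : RsqrtValid h y)
    (hy : Encloses δ y v) : Encloses δ (rsqrt h y) (√v)⁻¹ := by
  have hS := scale_pos
  have hh : (0 : ℝ) < h / scale := div_pos (by exact_mod_cast hv.1) hS
  have h1 := hy.abs_rsqrtArg_le (h := h) hδ
  have h2 : (rsqrtDev h y : ℝ) / scale ≤ 1 / 5 := by
    have : (5 * rsqrtDev h y : ℝ) ≤ scale := by exact_mod_cast hv.2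
    rw [div_le_div_iff₀ hS (by norm_num)]; linarith
  have hz : Encloses δ (rsqrtArg h y) ((h / scale : ℝ) ^ 2 * v) := by
    rw [sq]
    exact ((encloses_const h).mul hδ (encloses_const h)).mul hδ hy
  have e1 : (√v)⁻¹ = (h / scale : ℝ) * (√((h / scale : ℝ) ^ 2 * v))⁻¹ := by
    rw [Real.sqrt_mul (sq_nonneg _), Real.sqrt_sq hh.le, mul_inv, mul_inv_cancel_left₀ hh.ne']
  have h3 := abs_inv_sqrt_sub_le (h1.trans h2)
  rw [e1]
  refine (encloses_const h).mul hδ ?_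
  have hlin := ((encloses_const (δ := δ) (scale / 2)).mul hδ
    ((encloses_const (3 * scale)).sub hz))
  refine hlin.enlarge ?_
  set z := (h / scale : ℝ) ^ 2 * v
  have e2 : ((scale / 2 : ℤ) : ℝ) / scale * (((3 * scale : ℤ) : ℝ) / scale - z) = (3 - z) / 2 := by
    norm_num [scale]; ring
  rw [e2]
  set D := rsqrtDev h y
  have h4 : (z - 1) ^ 2 ≤ ((D : ℝ) / scale) ^ 2 := by
    rw [← sq_abs]; exact pow_le_pow_left₀ (abs_nonneg _) h1 2
  have h5 : ((D * D : ℤ) : ℝ) / ((2 * scale : ℤ) : ℝ) ≤ (D * D / (2 * scale) : ℤ) + 1 := by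
    have hd : (0 : ℤ) < 2 * scale := by decide
    rw [div_le_iff₀ (by exact_mod_cast hd)]
    exact_mod_cast (by
      have := Int.lt_ediv_add_one_mul_self (D * D) hd
      linarith)
  push_cast at h5 ⊢
  calc |(√z)⁻¹ - (3 - z) / 2| * scale ≤ (z - 1) ^ 2 / 2 * scale := by gcongr
    _ ≤ ((D : ℝ) / scale) ^ 2 / 2 * scale := by gcongr
    _ = (D : ℝ) * D / (2 * scale) := by field_simp
    _ ≤ _ := h5

lemma encloses_listSum {ι : Type*} {F : ι → AffineForm} {g : ι → ℝ} (l : List ι)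
    (h : ∀ i ∈ l, Encloses δ (F i) (g i)) : Encloses δ (listSum F l) (l.map g).sum := by
  induction l with
  | nil => simpa [listSum] using encloses_zero (δ := δ)
  | cons i l ih =>
    simp only [listSum, List.map_cons, List.sum_cons]
    exact (h i (by simp)).add (ih fun j hj => h j (by simp [hj]))

end AffineForm

/-! ### Taylor bounds for sine and cosine -/

lemma sum_range_exp_mul_I (x : ℝ) (n : ℕ) :
    ∑ m ∈ Finset.range (2 * n), ((x : ℂ) * Complex.I) ^ m / (m.factorial : ℂ)
      = ((∑ k ∈ Finset.range n, (-1) ^ k * x ^ (2 * k) / (2 * k).factorial : ℝ) : ℂ)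
        + ((∑ k ∈ Finset.range n, (-1) ^ k * x ^ (2 * k + 1) / (2 * k + 1).factorial : ℝ) : ℂ)
          * Complex.I := by
  induction n with
  | zero => simp
  | succ n ih =>
    rw [show 2 * (n + 1) = 2 * n + 1 + 1 by ring, Finset.sum_range_succ, Finset.sum_range_succ, ih,
      Finset.sum_range_succ, Finset.sum_range_succ]
    have h1 : (Complex.I) ^ (2 * n) = (-1) ^ n := by rw [pow_mul, Complex.I_sq]
    have h2 : (Complex.I) ^ (2 * n + 1) = (-1) ^ n * Complex.I := by rw [pow_succ, h1]
    rw [mul_pow, mul_pow, h1, h2]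
    push_cast
    ring

lemma norm_exp_mul_I_sub_le (x : ℝ) (n : ℕ) (hx : |x| ≤ n) :
    ‖Complex.exp (x * Complex.I) - ∑ m ∈ Finset.range (2 * n),
      ((x : ℂ) * Complex.I) ^ m / (m.factorial : ℂ)‖ ≤ |x| ^ (2 * n) / (2 * n).factorial * 2 := by
  have hn : ‖(x : ℂ) * Complex.I‖ = |x| := by simp
  have h := Complex.exp_bound' (x := (x : ℂ) * Complex.I) (n := 2 * n) (by
    rw [hn, div_le_iff₀ (by positivity)]
    push_cast
    linarith)
  rwa [hn] at h

lemma abs_cos_sub_sum_le (x : ℝ) (n : ℕ) (hx : |x| ≤ n) :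
    |Real.cos x - ∑ k ∈ Finset.range n, (-1) ^ k * x ^ (2 * k) / (2 * k).factorial|
      ≤ |x| ^ (2 * n) / (2 * n).factorial * 2 := by
  have h := (Complex.abs_re_le_norm _).trans (norm_exp_mul_I_sub_le x n hx)
  rw [sum_range_exp_mul_I, Complex.exp_mul_I, ← Complex.ofReal_cos, ← Complex.ofReal_sin] at h
  simpa only [Complex.sub_re, Complex.add_re, Complex.ofReal_re, Complex.re_ofReal_mul,
    Complex.I_re, mul_zero, add_zero] using h

lemma abs_sin_sub_sum_le (x : ℝ) (n : ℕ) (hx : |x| ≤ n) :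
    |Real.sin x - ∑ k ∈ Finset.range n, (-1) ^ k * x ^ (2 * k + 1) / (2 * k + 1).factorial|
      ≤ |x| ^ (2 * n) / (2 * n).factorial * 2 := by
  have h := (Complex.abs_im_le_norm _).trans (norm_exp_mul_I_sub_le x n hx)
  rw [sum_range_exp_mul_I, Complex.exp_mul_I, ← Complex.ofReal_cos, ← Complex.ofReal_sin] at h
  simpa only [Complex.sub_im, Complex.add_im, Complex.ofReal_im, Complex.im_ofReal_mul,
    Complex.I_im, mul_one, zero_add] using h

lemma abs_sin_sub_self_le (h : ℝ) : |Real.sin h - h| ≤ |h| ^ 3 / 6 := by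
  rcases lt_trichotomy h 0 with h0 | rfl | h0
  · have h1 := Real.sin_gt_sub_cube (neg_pos.2 h0)
    have h2 := Real.sin_lt (neg_pos.2 h0)
    rw [Real.sin_neg] at h1 h2
    rw [abs_of_neg h0, abs_le]
    constructor <;> linarith [pow_pos (neg_pos.2 h0) 3]
  · simp
  · have h1 := Real.sin_gt_sub_cube h0
    have h2 := Real.sin_lt h0
    rw [abs_of_pos h0, abs_le]
    constructor <;> linarith [pow_pos h0 3]

/-- Second-order expansion of the sine; the factor `|sin m|` matters when `m` is near `π`. -/
lemma abs_sin_add_sub_le (m h : ℝ) :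
    |Real.sin (m + h) - (Real.sin m + Real.cos m * h)| ≤ |Real.sin m| * h ^ 2 / 2 + |h| ^ 3 / 6 := by
  have h1 : |Real.cos h - 1| ≤ h ^ 2 / 2 := by
    rw [abs_le]
    constructor <;>
      linarith [Real.one_sub_sq_div_two_le_cos (x := h), Real.cos_le_one h, sq_nonneg h]
  have h2 := abs_sin_sub_self_le h
  rw [Real.sin_add]
  calc _ = |Real.sin m * (Real.cos h - 1) + Real.cos m * (Real.sin h - h)| := by
        congr 1; ring
    _ ≤ |Real.sin m| * (h ^ 2 / 2) + 1 * (|h| ^ 3 / 6) := by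
        refine (abs_add_le _ _).trans ?_
        rw [abs_mul, abs_mul]
        gcongr
        exact Real.abs_cos_le_one m
    _ = _ := by ring

namespace AffineForm

/-- The form of `sin (m + r δₖ)`, where `s` and `c` approximate `sin m` and `cos m`. The error is
`|s| r² / 2 + r³ / 6` from the Taylor expansion, and `30` units for the inaccuracy of `s` and `c` (at
most `10` units each) and for rounding. -/
def sinForm (k : ℕ) (r s c : ℤ) : AffineForm :=
  ⟨s, List.replicate k 0 ++ [c * r / scale],
    s.natAbs * r * r / (2 * scale * scale) + r * r * r / (6 * scale * scale) + 30⟩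

lemma linEval_replicate_append (k : ℕ) (a : ℤ) (δ : ℕ → ℝ) :
    linEval (List.replicate k 0 ++ [a]) δ = a * δ k := by
  induction k generalizing δ with
  | zero => simp [linEval]
  | succ k ih => simp [List.replicate_succ, linEval, ih]

lemma div_le_ediv_add_one (a : ℤ) {d : ℤ} (hd : 0 < d) : (a : ℝ) / d ≤ (a / d : ℤ) + 1 := by
  rw [div_le_iff₀ (by exact_mod_cast hd)]
  exact_mod_cast (Int.lt_ediv_add_one_mul_self a hd).le

lemma encloses_sinForm {δ : ℕ → ℝ} (hδ : ∀ n, |δ n| ≤ 1) (k : ℕ) {r s c : ℤ} {m : ℝ}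
    (hr0 : 0 ≤ r) (hr : r ≤ scale) (hs : |Real.sin m - s / scale| ≤ 10 / scale)
    (hc : |Real.cos m - c / scale| ≤ 10 / scale) :
    Encloses δ (sinForm k r s c) (Real.sin (m + r / scale * δ k)) := by
  have hS := scale_pos
  have hd1 := div_le_ediv_add_one (s.natAbs * r * r) (show 0 < 2 * scale * scale by decide)
  have hd2 := div_le_ediv_add_one (r * r * r) (show 0 < 6 * scale * scale by decide)
  have hd3 := abs_div_scale_sub_le (c * r)
  unfold Encloses sinForm
  simp only [linEval_replicate_append]
  push_cast at hd1 hd2 hd3 ⊢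
  set S : ℝ := (scale : ℝ) with hSdef
  set d := δ k with hd
  have hd' : |d| ≤ 1 := hδ k
  have hd4 : d ^ 2 ≤ 1 := by rw [← sq_abs]; exact pow_le_one₀ (abs_nonneg _) hd'
  have hr0' : (0 : ℝ) ≤ r := by exact_mod_cast hr0
  have hρ0 : 0 ≤ (r : ℝ) / S := by positivity
  have hρ1 : (r : ℝ) / S ≤ 1 := (div_le_one hS).2 (by rw [hSdef]; exact_mod_cast hr)
  set ρ := (r : ℝ) / S with hρ
  have hrS : (r : ℝ) = ρ * S := by rw [hρ]; field_simp
  have t1 := abs_sin_add_sub_le m (ρ * d)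
  have hcube : |ρ * d| ^ 3 ≤ ρ ^ 3 := by
    rw [abs_mul, abs_of_nonneg hρ0]
    exact pow_le_pow_left₀ (by positivity) (mul_le_of_le_one_right hρ0 hd') 3
  have hsq : (ρ * d) ^ 2 ≤ ρ ^ 2 := by
    rw [mul_pow]; exact mul_le_of_le_one_right (by positivity) hd4
  have hs' : |Real.sin m| ≤ |(s : ℝ)| / S + 10 / S := by
    have := abs_add_le (Real.sin m - s / S) (s / S)
    rw [sub_add_cancel, abs_div (s : ℝ), abs_of_pos hS] at this
    linarith
  have t2 : |Real.sin (m + ρ * d) - (Real.sin m + Real.cos m * (ρ * d))| * S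
      ≤ |(s : ℝ)| * r * r / (2 * S * S) + r * r * r / (6 * S * S) + 5 := by
    calc _ ≤ ((|(s : ℝ)| / S + 10 / S) * ρ ^ 2 / 2 + ρ ^ 3 / 6) * S := by
          refine mul_le_mul_of_nonneg_right (t1.trans ?_) hS.le
          gcongr
      _ = |(s : ℝ)| * r * r / (2 * S * S) + r * r * r / (6 * S * S) + 5 * ρ ^ 2 := by
          rw [hrS]; field_simp; ring
      _ ≤ _ := by
          have : ρ ^ 2 ≤ 1 := pow_le_one₀ hρ0 hρ1
          linarith
  have t3 : |(Real.sin m - s / S) * S| ≤ 10 := by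
    rw [abs_mul, abs_of_pos hS, ← le_div_iff₀ hS]; exact hs
  have t4 : |(Real.cos m - c / S) * S * (ρ * d)| ≤ 10 := by
    rw [abs_mul, abs_mul, abs_of_pos hS]
    have h1 : |Real.cos m - c / S| * S ≤ 10 := by rw [← le_div_iff₀ hS]; exact hc
    have h2 : |ρ * d| ≤ 1 := by
      rw [abs_mul, abs_of_nonneg hρ0]; exact mul_le_one₀ hρ1 (abs_nonneg _) hd'
    calc _ ≤ (10 : ℝ) * 1 := by gcongr
      _ = 10 := by norm_num
  have t5 : |((c : ℝ) * r / S - (c * r / scale : ℤ)) * d| ≤ 1 := by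
    rw [abs_mul]; exact mul_le_one₀ hd3 (abs_nonneg _) hd'
  have key : Real.sin (m + ρ * d) * S - (s + (c * r / scale : ℤ) * d)
      = (Real.sin (m + ρ * d) - (Real.sin m + Real.cos m * (ρ * d))) * S
        + (Real.sin m - s / S) * S + (Real.cos m - c / S) * S * (ρ * d)
        + ((c : ℝ) * r / S - (c * r / scale : ℤ)) * d := by
    rw [hrS]; field_simp; ring
  rw [key]
  refine (abs_add_le _ _).trans ?_
  have t2' : |(Real.sin (m + ρ * d) - (Real.sin m + Real.cos m * (ρ * d))) * S|
      ≤ |(s : ℝ)| * r * r / (2 * S * S) + r * r * r / (6 * S * S) + 5 := by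
    rw [abs_mul, abs_of_pos hS]; exact t2
  have := abs_add_three ((Real.sin (m + ρ * d) - (Real.sin m + Real.cos m * (ρ * d))) * S)
    ((Real.sin m - s / S) * S) ((Real.cos m - c / S) * S * (ρ * d))
  linarith

/-- The cosine is the sine shifted by `π / 2`, which turns `(sin m, cos m)` into
`(cos m, -sin m)`. -/
lemma encloses_cosForm {δ : ℕ → ℝ} (hδ : ∀ n, |δ n| ≤ 1) (k : ℕ) {r s c : ℤ} {m : ℝ}
    (hr0 : 0 ≤ r) (hr : r ≤ scale) (hs : |Real.sin m - s / scale| ≤ 10 / scale)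
    (hc : |Real.cos m - c / scale| ≤ 10 / scale) :
    Encloses δ (sinForm k r c (-s)) (Real.cos (m + r / scale * δ k)) := by
  rw [← Real.sin_add_pi_div_two, add_right_comm]
  refine encloses_sinForm hδ k hr0 hr (by rwa [Real.sin_add_pi_div_two]) ?_
  rw [Real.cos_add_pi_div_two, ← abs_neg]
  push_cast
  convert hs using 2
  ring

end AffineForm

/-! ### The box and its noise variables -/

/-- The centre of the box, in units of `1 / scale`. -/
def center : Fin 7 → ℤ :=
  ![-5118163697000, 13148881420000, 31415926535000, -2473967821500, -15046642695000,
    -2473967821500, 15046642695000]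

/-- The radii of the box, in units of `1 / scale`. -/
def radius : Fin 7 → ℤ :=
  ![39716722000, 39716730000, 39716735000, 39716722500, 39716735000, 39716722500, 39716735000]

/-- Approximate sines of the coordinates of the centre, in units of `1 / scale`. -/
def sinCenter : Fin 7 → ℤ :=
  ![-4897616673941, 9674338112112, 898, -2448808336960, -9978140723435, -2448808336960,
    9978140723435]

/-- Approximate cosines of the coordinates of the centre, in units of `1 / scale`. -/
def cosCenter : Fin 7 → ℤ :=
  ![8718563580954, 2531241215793, -10000000000000, 9695531843526, 660838636381, 9695531843526,
    660838636381]

/-- A bound on `n` terms of the Taylor series gives a bound on the sine. -/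
lemma abs_sin_sub_le_of_sum (x a e : ℝ) (n : ℕ) (hx : |x| ≤ n)
    (h : |∑ k ∈ Finset.range n, (-1) ^ k * x ^ (2 * k + 1) / (2 * k + 1).factorial - a|
      + |x| ^ (2 * n) / (2 * n).factorial * 2 ≤ e) : |Real.sin x - a| ≤ e :=
  (abs_sub_le _ _ _).trans ((add_le_add_left (abs_sin_sub_sum_le x n hx) _).trans (by linarith))

lemma abs_cos_sub_le_of_sum (x a e : ℝ) (n : ℕ) (hx : |x| ≤ n)
    (h : |∑ k ∈ Finset.range n, (-1) ^ k * x ^ (2 * k) / (2 * k).factorial - a|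
      + |x| ^ (2 * n) / (2 * n).factorial * 2 ≤ e) : |Real.cos x - a| ≤ e :=
  (abs_sub_le _ _ _).trans ((add_le_add_left (abs_cos_sub_sum_le x n hx) _).trans (by linarith))

lemma abs_sin_center_sub_le (i : Fin 7) :
    |Real.sin (center i / scale) - sinCenter i / scale| ≤ 10 / scale := by
  refine abs_sin_sub_le_of_sum _ _ _ 16 ?_ ?_ <;> fin_cases i <;>
    norm_num [center, sinCenter, scale, Finset.sum_range_succ, Nat.factorial, abs_le,
      abs_div, abs_of_pos, abs_of_neg]

lemma abs_cos_center_sub_le (i : Fin 7) :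
    |Real.cos (center i / scale) - cosCenter i / scale| ≤ 10 / scale := by
  refine abs_cos_sub_le_of_sum _ _ _ 16 ?_ ?_ <;> fin_cases i <;>
    norm_num [center, cosCenter, scale, Finset.sum_range_succ, Nat.factorial, abs_le,
      abs_div, abs_of_pos, abs_of_neg]

lemma boxLower_eq (i : Fin 7) : boxLower i = (center i - radius i : ℤ) / scale := by
  fin_cases i <;> norm_num [boxLower, center, radius, scale]

lemma boxUpper_eq (i : Fin 7) : boxUpper i = (center i + radius i : ℤ) / scale := by
  fin_cases i <;> norm_num [boxUpper, center, radius, scale]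

/-- The noise variables of a point: its coordinates relative to the box. -/
noncomputable def noise (x : Fin 7 → ℝ) (n : ℕ) : ℝ :=
  if h : n < 7 then (x ⟨n, h⟩ - center ⟨n, h⟩ / scale) / (radius ⟨n, h⟩ / scale) else 0

lemma radius_pos (i : Fin 7) : 0 < radius i := by
  revert i; decide

lemma radius_le_scale (i : Fin 7) : radius i ≤ scale := by
  revert i; decide

lemma eq_center_add_noise (x : Fin 7 → ℝ) (i : Fin 7) :
    x i = center i / scale + radius i / scale * noise x i := by
  have hS := AffineForm.scale_pos
  have hr : (0 : ℝ) < radius i := by exact_mod_cast radius_pos i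
  simp only [noise, i.2, dite_true, Fin.eta]
  field_simp
  ring

lemma abs_noise_le {x : Fin 7 → ℝ} (hx : x ∈ boxP) (n : ℕ) : |noise x n| ≤ 1 := by
  have hS := AffineForm.scale_pos
  unfold noise
  split_ifs with h
  · have hr : (0 : ℝ) < radius ⟨n, h⟩ := by exact_mod_cast radius_pos ⟨n, h⟩
    have h1 := hx.1 ⟨n, h⟩
    have h2 := hx.2 ⟨n, h⟩
    rw [boxLower_eq] at h1
    rw [boxUpper_eq] at h2
    push_cast at h1 h2
    rw [sub_div] at h1
    rw [add_div] at h2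
    rw [abs_div, abs_of_pos (div_pos hr hS), div_le_one (div_pos hr hS), abs_le]
    constructor <;> linarith
  · simp

/-! ### Affine forms of the distances and of their second derivatives -/

/-- The vector of the latitudes of the five points, as a function of the seven coordinates; the
latitude of the first point is fixed, so it does not vary. -/
def latVec {R : Type*} [Zero R] (v : Fin 7 → R) : Fin 5 → R := ![0, v 0, v 1, v 3, v 5]

/-- The variable part of the longitudes of the five points; the longitudes of the first two points
are fixed. -/
def lonVec {R : Type*} [Zero R] (v : Fin 7 → R) : Fin 5 → R := ![0, 0, v 2, v 4, v 6]

/-- The ten pairs of points. -/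
def pairs : List (Fin 5 × Fin 5) :=
  [(0, 1), (0, 2), (0, 3), (0, 4), (1, 2), (1, 3), (1, 4), (2, 3), (2, 4), (3, 4)]

/-- Approximate reciprocal distances at the centre of the box, in units of `1 / scale`; only the
entries above the diagonal matter. -/
def invDistCenter : Fin 5 → Fin 5 → ℤ :=
  ![![0, 5168312231937, 6316666632490, 7309097250923, 7309097250923],
    ![0, 0, 6316666632222, 7309097254778, 7309097254778],
    ![0, 0, 0, 6316666632640, 6316666632751],
    ![0, 0, 0, 0, 5168312231749],
    ![0, 0, 0, 0, 0]]

/-- The matrix `hessLower` in units of `1 / scale`. -/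
def hessLowerInt : Fin 7 → Fin 7 → ℤ :=
  ![![-8569458875000, 3856326448000, -5396514777, -6654530730000, 2585282072000,
      -6654530721000, -2727361235000],
    ![3856326448000, -11345592980000, -121834769800, -1714593475000, -5947446572000,
      -1714593468000, 5875949418000],
    ![-5396514777, -121834769800, -808585453900, -995957797100, 233519522000, 938559536100,
      233519522300],
    ![-6654530730000, -1714593475000, -995957797100, -8828398133000, -1171472526000,
      -4897161727000, 61696327900],
    ![2585282072000, -5947446572000, 233519522000, -1171472526000, -11644120640000,
      -100239578900, 4813603601000],
    ![-6654530721000, -1714593468000, 938559536100, -4897161727000, -100239578900,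
      -8828398113000, 857532395000],
    ![-2727361235000, 5875949418000, 233519522300, 61696327900, 4813603601000, 857532395000,
      -11644120620000]]

/-- The matrix `hessUpper` in units of `1 / scale`. -/
def hessUpperInt : Fin 7 → Fin 7 → ℤ :=
  ![![-8085653887000, 4060471777000, 5396514777, -6522387542000, 2727361243000, -6522387553000,
      -2585282080000],
    ![4060471777000, -10884092260000, 121834771700, -1584190467000, -5875949419000,
      -1584190466000, 5947446571000],
    ![5396514777, 121834771700, -616555936400, -938559536300, 274251832500, 995957797100,
      274251829300],
    ![-6522387542000, -1584190467000, -938559536300, -8391511385000, -857532386800,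
      -4822526949000, 100239578900],
    ![2727361243000, -5875949419000, 274251832500, -857532386800, -11283966350000,
      -61696327900, 4860701132000],
    ![-6522387553000, -1584190466000, 995957797100, -4822526949000, -61696327900,
      -8391511402000, 1171472521000],
    ![-2585282080000, 5947446571000, 274251829300, 100239578900, 4860701132000, 1171472521000,
      -11283966380000]]

namespace AffineForm

/-- Sine of a coordinate. -/
def sinCoord (i : Fin 7) : AffineForm := sinForm i (radius i) (sinCenter i) (cosCenter i)

/-- Cosine of a coordinate. -/
def cosCoord (i : Fin 7) : AffineForm := sinForm i (radius i) (cosCenter i) (-sinCenter i)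

/-- Sine of the latitude of a point. -/
def sinLat : Fin 5 → AffineForm :=
  ![const 0, sinCoord 0, sinCoord 1, sinCoord 3, sinCoord 5]

/-- Cosine of the latitude of a point. -/
def cosLat : Fin 5 → AffineForm :=
  ![const scale, cosCoord 0, cosCoord 1, cosCoord 3, cosCoord 5]

/-- Sine of the longitude of a point. -/
def sinLon : Fin 5 → AffineForm :=
  ![const 0, const 0, sinCoord 2, sinCoord 4, sinCoord 6]

/-- Cosine of the longitude of a point; the second point has longitude `π`. -/
def cosLon : Fin 5 → AffineForm :=
  ![const scale, const (-scale), cosCoord 2, cosCoord 4, cosCoord 6]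

/-- Cosine of the difference of two longitudes. -/
def cosDiff (k l : Fin 5) : AffineForm :=
  add (mul (cosLon k) (cosLon l)) (mul (sinLon k) (sinLon l))

/-- Sine of the difference of two longitudes. -/
def sinDiff (k l : Fin 5) : AffineForm :=
  sub (mul (sinLon k) (cosLon l)) (mul (cosLon k) (sinLon l))

/-- Product of the cosines of two latitudes. -/
def cosCos (k l : Fin 5) : AffineForm := mul (cosLat k) (cosLat l)

/-- Inner product of two of the points. -/
def inner (k l : Fin 5) : AffineForm :=
  add (mul (cosCos k l) (cosDiff k l)) (mul (sinLat k) (sinLat l))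

/-- Squared distance of two of the points. -/
def sqDist (k l : Fin 5) : AffineForm := sub (const (2 * scale)) (smul 2 (inner k l))

/-- Reciprocal distance of two of the points. -/
def invDist (k l : Fin 5) : AffineForm := rsqrt (invDistCenter k l) (sqDist k l)

/-- The derivative of the inner product in a direction whose components along the latitude and
longitude of the first and second point are `a₁, a₂, a₃, a₄`. -/
def innerDeriv (k l : Fin 5) (a₁ a₂ a₃ a₄ : ℤ) : AffineForm :=
  add (smul a₁ (sub (mul (cosLat k) (sinLat l)) (mul (mul (sinLat k) (cosLat l)) (cosDiff k l))))
    (add (smul a₂ (neg (mul (cosCos k l) (sinDiff k l))))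
      (add (smul a₃ (sub (mul (sinLat k) (cosLat l))
          (mul (mul (cosLat k) (sinLat l)) (cosDiff k l))))
        (smul a₄ (mul (cosCos k l) (sinDiff k l)))))

/-- The second derivative of the inner product in two directions, as a bilinear form in them. The
matrix entries not named equal, up to sign, one of those named. -/
def innerDeriv₂ (k l : Fin 5) (a₁ a₂ a₃ a₄ b₁ b₂ b₃ b₄ : ℤ) : AffineForm :=
  let h₁₁ := neg (inner k l)
  let h₁₂ := mul (mul (sinLat k) (cosLat l)) (sinDiff k l)
  let h₁₃ := add (mul (mul (sinLat k) (sinLat l)) (cosDiff k l)) (cosCos k l)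
  let h₂₂ := neg (mul (cosCos k l) (cosDiff k l))
  let h₂₃ := mul (mul (cosLat k) (sinLat l)) (sinDiff k l)
  let h₂₄ := mul (cosCos k l) (cosDiff k l)
  add (smul a₁ (add (smul b₁ h₁₁) (add (smul b₂ h₁₂) (add (smul b₃ h₁₃) (smul b₄ (neg h₁₂))))))
    (add (smul a₂ (add (smul b₁ h₁₂) (add (smul b₂ h₂₂) (add (smul b₃ h₂₃) (smul b₄ h₂₄)))))
      (add (smul a₃ (add (smul b₁ h₁₃) (add (smul b₂ h₂₃) (add (smul b₃ h₁₁)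
          (smul b₄ (neg h₂₃))))))
        (smul a₄ (add (smul b₁ (neg h₁₂)) (add (smul b₂ h₂₄) (add (smul b₃ (neg h₂₃))
          (smul b₄ h₂₂)))))))

/-- Second derivative of the distance of two points along the coordinates `i` and `j`. -/
def distDeriv₂ (i j : Fin 7) (p : Fin 5 × Fin 5) : AffineForm :=
  let k := p.1
  let l := p.2
  let u : Fin 7 → ℤ := fun n => if n = i then 1 else 0
  let v : Fin 7 → ℤ := fun n => if n = j then 1 else 0
  let w := invDist k l
  neg (add
    (mul w (innerDeriv₂ k l (latVec u k) (lonVec u k) (latVec u l) (lonVec u l)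
      (latVec v k) (lonVec v k) (latVec v l) (lonVec v l)))
    (mul (mul w (mul w w))
      (mul (innerDeriv k l (latVec u k) (lonVec u k) (latVec u l) (lonVec u l))
        (innerDeriv k l (latVec v k) (lonVec v k) (latVec v l) (lonVec v l)))))

/-- The Hessian entry `(i, j)` of the sum of the distances over the box. -/
def hessForm (i j : Fin 7) : AffineForm := listSum (distDeriv₂ i j) pairs

/-- The sum of the distances over the box. -/
def sumForm : AffineForm :=
  listSum (fun p => mul (sqDist p.1 p.2) (invDist p.1 p.2)) pairs

lemma rsqrtValid_sqDist : ∀ p ∈ pairs, RsqrtValid (invDistCenter p.1 p.2) (sqDist p.1 p.2) := by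
  decide +kernel

/-- In units of `1 / scale`, the bound is `15.68`. -/
lemma upper_sumForm_le : upper sumForm ≤ 156800000000000 := by
  decide +kernel

set_option maxRecDepth 10000 in
/-- The Hessian entries over the box lie between the prescribed bounds. -/
lemma hessForm_bounds : ∀ i j, hessLowerInt i j ≤ lower (hessForm i j) ∧
    upper (hessForm i j) ≤ hessUpperInt i j := by
  decide +kernel

end AffineForm

/-! ### Derivatives of the distance in spherical coordinates -/

/-- Inner product of the points of the sphere with angles `(p, t)` and `(q, e)`. -/
noncomputable def angInner (p t q e : ℝ) : ℝ :=
  Real.cos p * Real.cos q * Real.cos (t - e) + Real.sin p * Real.sin q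

/-- Derivative of `angInner` in the direction `(a₁, a₂, a₃, a₄)`. -/
noncomputable def angInnerDeriv (p t q e a₁ a₂ a₃ a₄ : ℝ) : ℝ :=
  a₁ * (Real.cos p * Real.sin q - Real.sin p * Real.cos q * Real.cos (t - e))
    + (a₂ * -(Real.cos p * Real.cos q * Real.sin (t - e))
      + (a₃ * (Real.sin p * Real.cos q - Real.cos p * Real.sin q * Real.cos (t - e))
        + a₄ * (Real.cos p * Real.cos q * Real.sin (t - e))))

/-- Second derivative of `angInner` in the directions `(a₁, a₂, a₃, a₄)` and
`(b₁, b₂, b₃, b₄)`. -/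
noncomputable def angInnerDeriv₂ (p t q e a₁ a₂ a₃ a₄ b₁ b₂ b₃ b₄ : ℝ) : ℝ :=
  let h₁₁ := -angInner p t q e
  let h₁₂ := Real.sin p * Real.cos q * Real.sin (t - e)
  let h₁₃ := Real.sin p * Real.sin q * Real.cos (t - e) + Real.cos p * Real.cos q
  let h₂₂ := -(Real.cos p * Real.cos q * Real.cos (t - e))
  let h₂₃ := Real.cos p * Real.sin q * Real.sin (t - e)
  let h₂₄ := Real.cos p * Real.cos q * Real.cos (t - e)
  a₁ * (b₁ * h₁₁ + (b₂ * h₁₂ + (b₃ * h₁₃ + b₄ * -h₁₂)))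
    + (a₂ * (b₁ * h₁₂ + (b₂ * h₂₂ + (b₃ * h₂₃ + b₄ * h₂₄)))
      + (a₃ * (b₁ * h₁₃ + (b₂ * h₂₃ + (b₃ * h₁₁ + b₄ * -h₂₃)))
        + a₄ * (b₁ * -h₁₂ + (b₂ * h₂₄ + (b₃ * -h₂₃ + b₄ * h₂₂)))))

/-- Distance of the points of the sphere with angles `(p, t)` and `(q, e)`. -/
noncomputable def angDist (p t q e : ℝ) : ℝ := √(2 - 2 * angInner p t q e)

/-- Derivative of `angDist` in a direction, where the distance is not zero. -/
noncomputable def angDistDeriv (p t q e a₁ a₂ a₃ a₄ : ℝ) : ℝ :=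
  -((angDist p t q e)⁻¹ * angInnerDeriv p t q e a₁ a₂ a₃ a₄)

/-- Second derivative of `angDist` in two directions, where the distance is not zero. -/
noncomputable def angDistDeriv₂ (p t q e a₁ a₂ a₃ a₄ b₁ b₂ b₃ b₄ : ℝ) : ℝ :=
  -((angDist p t q e)⁻¹ * angInnerDeriv₂ p t q e a₁ a₂ a₃ a₄ b₁ b₂ b₃ b₄
    + (angDist p t q e)⁻¹ * ((angDist p t q e)⁻¹ * (angDist p t q e)⁻¹)
      * (angInnerDeriv p t q e a₁ a₂ a₃ a₄ * angInnerDeriv p t q e b₁ b₂ b₃ b₄))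

section
variable {p t q e : ℝ → ℝ} {a₁ a₂ a₃ a₄ τ : ℝ} (hp : HasDerivAt p a₁ τ) (ht : HasDerivAt t a₂ τ)
  (hq : HasDerivAt q a₃ τ) (he : HasDerivAt e a₄ τ)
include hp ht hq he

lemma hasDerivAt_angInner :
    HasDerivAt (fun τ => angInner (p τ) (t τ) (q τ) (e τ))
      (angInnerDeriv (p τ) (t τ) (q τ) (e τ) a₁ a₂ a₃ a₄) τ := by
  unfold angInner angInnerDeriv
  refine (((hp.cos.fun_mul hq.cos).fun_mul (ht.fun_sub he).cos).fun_add
    (hp.sin.fun_mul hq.sin)).congr_deriv ?_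
  ring

lemma hasDerivAt_angInnerDeriv (b₁ b₂ b₃ b₄ : ℝ) :
    HasDerivAt (fun τ => angInnerDeriv (p τ) (t τ) (q τ) (e τ) b₁ b₂ b₃ b₄)
      (angInnerDeriv₂ (p τ) (t τ) (q τ) (e τ) a₁ a₂ a₃ a₄ b₁ b₂ b₃ b₄) τ := by
  unfold angInnerDeriv angInnerDeriv₂ angInner
  have hC := (ht.fun_sub he).cos
  have hS := (ht.fun_sub he).sin
  refine ((((hp.cos.fun_mul hq.sin).fun_sub ((hp.sin.fun_mul hq.cos).fun_mul hC)).const_mul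
    b₁).fun_add ((((hp.cos.fun_mul hq.cos).fun_mul hS).fun_neg.const_mul b₂).fun_add
    ((((hp.sin.fun_mul hq.cos).fun_sub ((hp.cos.fun_mul hq.sin).fun_mul hC)).const_mul b₃).fun_add
    (((hp.cos.fun_mul hq.cos).fun_mul hS).const_mul b₄)))).congr_deriv ?_
  ring

lemma hasDerivAt_angDist (h : 0 < 2 - 2 * angInner (p τ) (t τ) (q τ) (e τ)) :
    HasDerivAt (fun τ => angDist (p τ) (t τ) (q τ) (e τ))
      (angDistDeriv (p τ) (t τ) (q τ) (e τ) a₁ a₂ a₃ a₄) τ := by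
  have h1 := (((hasDerivAt_angInner hp ht hq he).const_mul 2).const_sub 2).sqrt h.ne'
  unfold angDist angDistDeriv
  refine h1.congr_deriv ?_
  rw [angDist]
  field_simp

lemma hasDerivAt_angDistDeriv (b₁ b₂ b₃ b₄ : ℝ)
    (h : 0 < 2 - 2 * angInner (p τ) (t τ) (q τ) (e τ)) :
    HasDerivAt (fun τ => angDistDeriv (p τ) (t τ) (q τ) (e τ) b₁ b₂ b₃ b₄)
      (angDistDeriv₂ (p τ) (t τ) (q τ) (e τ) a₁ a₂ a₃ a₄ b₁ b₂ b₃ b₄) τ := by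
  have h0 : angDist (p τ) (t τ) (q τ) (e τ) ≠ 0 := (Real.sqrt_pos.2 h).ne'
  have h1 := (hasDerivAt_angDist hp ht hq he h).fun_inv h0
  have h2 := hasDerivAt_angInnerDeriv hp ht hq he b₁ b₂ b₃ b₄
  refine (h1.fun_mul h2).fun_neg.congr_deriv ?_
  unfold angDistDeriv₂ angDistDeriv
  field_simp
  ring

end

/-- The longitudes of the five points. -/
noncomputable def lonAng (x : Fin 7 → ℝ) : Fin 5 → ℝ := ![0, Real.pi, x 2, x 4, x 6]

/-- Inner product of the points `k` and `l` of the configuration `x`. -/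
noncomputable def pairInner (x : Fin 7 → ℝ) (k : Fin 5 × Fin 5) : ℝ :=
  angInner (latVec x k.1) (lonAng x k.1) (latVec x k.2) (lonAng x k.2)

/-- Distance of a pair of points of the configuration `x`. -/
noncomputable def pairDist (x : Fin 7 → ℝ) (k : Fin 5 × Fin 5) : ℝ :=
  angDist (latVec x k.1) (lonAng x k.1) (latVec x k.2) (lonAng x k.2)

/-- Derivative of `pairDist` at `x` in the direction `u`. -/
noncomputable def pairDistDeriv (x u : Fin 7 → ℝ) (k : Fin 5 × Fin 5) : ℝ :=
  angDistDeriv (latVec x k.1) (lonAng x k.1) (latVec x k.2) (lonAng x k.2)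
    (latVec u k.1) (lonVec u k.1) (latVec u k.2) (lonVec u k.2)

/-- Second derivative of `pairDist` at `x` in the directions `u` and `v`. -/
noncomputable def pairDistDeriv₂ (x u v : Fin 7 → ℝ) (k : Fin 5 × Fin 5) : ℝ :=
  angDistDeriv₂ (latVec x k.1) (lonAng x k.1) (latVec x k.2) (lonAng x k.2)
    (latVec u k.1) (lonVec u k.1) (latVec u k.2) (lonVec u k.2)
    (latVec v k.1) (lonVec v k.1) (latVec v k.2) (lonVec v k.2)

/-- The configurations in which no two points coincide. -/
def Separated (x : Fin 7 → ℝ) : Prop := ∀ k ∈ pairs, 0 < 2 - 2 * pairInner x k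

lemma points_eq (x : Fin 7 → ℝ) (k : Fin 5) :
    points x k = sphPoint (latVec x k) (lonAng x k) := by
  fin_cases k <;> rfl

lemma dist_sphPoint (p t q e : ℝ) : dist (sphPoint p t) (sphPoint q e) = angDist p t q e := by
  rw [EuclideanSpace.dist_eq, angDist, angInner, Real.cos_sub]
  congr 1
  simp only [sphPoint, Fin.sum_univ_three, Real.dist_eq, sq_abs]
  simp only [Matrix.cons_val_zero, Matrix.cons_val_one, Matrix.cons_val]
  nlinarith [Real.sin_sq_add_cos_sq p, Real.sin_sq_add_cos_sq q, Real.sin_sq_add_cos_sq t,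
    Real.sin_sq_add_cos_sq e]

lemma f_eq (x : Fin 7 → ℝ) : f x = (pairs.map (pairDist x)).sum := by
  have h0 : Finset.Ioi (0 : Fin 5) = {1, 2, 3, 4} := by decide
  have h1 : Finset.Ioi (1 : Fin 5) = {2, 3, 4} := by decide
  have h2 : Finset.Ioi (2 : Fin 5) = {3, 4} := by decide
  have h3 : Finset.Ioi (3 : Fin 5) = {4} := by decide
  have h4 : Finset.Ioi (4 : Fin 5) = ∅ := by decide
  simp only [f, points_eq, dist_sphPoint, Fin.sum_univ_five, h0, h1, h2, h3, h4]
  simp [pairs, pairDist]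
  ring

lemma hasDerivAt_line (x u : Fin 7 → ℝ) (i : Fin 7) :
    HasDerivAt (fun τ : ℝ => (x + τ • u) i) (u i) 0 := by
  simpa using ((hasDerivAt_id (0 : ℝ)).mul_const (u i)).const_add (x i)

lemma hasDerivAt_latVec (x u : Fin 7 → ℝ) (k : Fin 5) :
    HasDerivAt (fun τ : ℝ => latVec (x + τ • u) k) (latVec u k) 0 := by
  fin_cases k
  · exact hasDerivAt_const _ _
  all_goals exact hasDerivAt_line x u _

lemma hasDerivAt_lonAng (x u : Fin 7 → ℝ) (k : Fin 5) :
    HasDerivAt (fun τ : ℝ => lonAng (x + τ • u) k) (lonVec u k) 0 := by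
  fin_cases k
  · exact hasDerivAt_const _ _
  · exact hasDerivAt_const _ _
  all_goals exact hasDerivAt_line x u _

lemma hasDerivAt_list_sum {ι : Type*} (l : List ι) {F : ℝ → ι → ℝ} {G : ι → ℝ} {τ : ℝ}
    (h : ∀ i ∈ l, HasDerivAt (fun τ => F τ i) (G i) τ) :
    HasDerivAt (fun τ => (l.map (F τ)).sum) (l.map G).sum τ := by
  induction l with
  | nil => simpa using hasDerivAt_const _ _
  | cons i l ih =>
    simp only [List.map_cons, List.sum_cons]
    exact (h i (by simp)).add (ih fun j hj => h j (by simp [hj]))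

lemma Separated.hasDerivAt_f {x : Fin 7 → ℝ} (hx : Separated x) (u : Fin 7 → ℝ) :
    HasDerivAt (fun τ : ℝ => f (x + τ • u)) (pairs.map (pairDistDeriv x u)).sum 0 := by
  simp only [f_eq]
  refine hasDerivAt_list_sum pairs fun k hk => ?_
  have h := hasDerivAt_angDist (hasDerivAt_latVec x u k.1) (hasDerivAt_lonAng x u k.1)
    (hasDerivAt_latVec x u k.2) (hasDerivAt_lonAng x u k.2) (by
      simp only [zero_smul, add_zero]
      exact hx k hk)
  simp only [zero_smul, add_zero] at h
  exact h

lemma Separated.hasDerivAt_pairDistDeriv {x : Fin 7 → ℝ} (hx : Separated x) (u v : Fin 7 → ℝ) :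
    HasDerivAt (fun τ : ℝ => (pairs.map (pairDistDeriv (x + τ • u) v)).sum)
      (pairs.map (pairDistDeriv₂ x u v)).sum 0 := by
  refine hasDerivAt_list_sum pairs fun k hk => ?_
  have h := hasDerivAt_angDistDeriv (hasDerivAt_latVec x u k.1) (hasDerivAt_lonAng x u k.1)
    (hasDerivAt_latVec x u k.2) (hasDerivAt_lonAng x u k.2) (latVec v k.1) (lonVec v k.1)
    (latVec v k.2) (lonVec v k.2) (by
      simp only [zero_smul, add_zero]
      exact hx k hk)
  simp only [zero_smul, add_zero] at h
  exact h

lemma contDiff_pairInner (k : Fin 5 × Fin 5) {n : WithTop ℕ∞} :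
    ContDiff ℝ n (fun x => pairInner x k) := by
  have hc : ∀ i : Fin 7, ContDiff ℝ n (fun x : Fin 7 → ℝ => x i) := fun i => contDiff_apply ℝ ℝ i
  have h1 : ∀ k : Fin 5, ContDiff ℝ n (fun x : Fin 7 → ℝ => latVec x k) := by
    intro k
    fin_cases k
    · exact contDiff_const
    all_goals exact hc _
  have h2 : ∀ k : Fin 5, ContDiff ℝ n (fun x : Fin 7 → ℝ => lonAng x k) := by
    intro k
    fin_cases k
    · exact contDiff_const
    · exact contDiff_const
    all_goals exact hc _
  unfold pairInner angInner
  exact (((h1 _).cos.mul (h1 _).cos).mul ((h2 _).sub (h2 _)).cos).add ((h1 _).sin.mul (h1 _).sin)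

lemma Separated.contDiffAt {x : Fin 7 → ℝ} (hx : Separated x) {n : WithTop ℕ∞} :
    ContDiffAt ℝ n f x := by
  have h : ∀ k ∈ pairs, ContDiffAt ℝ n (fun y => pairDist y k) x := fun k hk =>
    (contDiffAt_const.sub (contDiffAt_const.mul (contDiff_pairInner k).contDiffAt)).sqrt
      (hx k hk).ne'
  rw [show f = fun y => (pairs.map (pairDist y)).sum from funext f_eq]
  generalize pairs = l at h
  induction l with
  | nil => simpa using contDiffAt_const
  | cons i l ih =>
    simp only [List.map_cons, List.sum_cons]
    exact (h i (by simp)).add (ih fun j hj => h j (by simp [hj]))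

lemma Separated.eventually {x : Fin 7 → ℝ} (hx : Separated x) : ∀ᶠ y in nhds x, Separated y := by
  have h : ∀ k ∈ pairs, ∀ᶠ y in nhds x, 0 < 2 - 2 * pairInner y k := fun k hk =>
    have hc : Continuous fun y => 2 - 2 * pairInner y k :=
      continuous_const.sub (continuous_const.mul (contDiff_pairInner k (n := 0)).continuous)
    hc.continuousAt.eventually (lt_mem_nhds (hx k hk))
  have h' := (Filter.eventually_all_finset pairs.toFinset).2
    fun k hk => h k (List.mem_toFinset.1 hk)
  filter_upwards [h'] with y hy k hk using hy k (List.mem_toFinset.2 hk)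

lemma Separated.fderiv_f {x : Fin 7 → ℝ} (hx : Separated x) (u : Fin 7 → ℝ) :
    fderiv ℝ f x u = (pairs.map (pairDistDeriv x u)).sum := by
  have hd : DifferentiableAt ℝ f x := (hx.contDiffAt (n := 1)).differentiableAt one_ne_zero
  have h := hd.hasFDerivAt.hasLineDerivAt u
  exact h.unique (hx.hasDerivAt_f u)

lemma Separated.differentiableAt_fderiv {x : Fin 7 → ℝ} (hx : Separated x) :
    DifferentiableAt ℝ (fderiv ℝ f) x :=
  ((hx.contDiffAt (n := 2)).fderiv_right (m := 1) (by norm_num)).differentiableAt one_ne_zero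

lemma Separated.fderiv_fderiv_f {x : Fin 7 → ℝ} (hx : Separated x) (u v : Fin 7 → ℝ) :
    fderiv ℝ (fderiv ℝ f) x u v = (pairs.map (pairDistDeriv₂ x u v)).sum := by
  have h1 : HasFDerivAt (fun y => fderiv ℝ f y v)
      ((ContinuousLinearMap.apply ℝ ℝ v).comp (fderiv ℝ (fderiv ℝ f) x)) x :=
    (ContinuousLinearMap.apply ℝ ℝ v).hasFDerivAt.comp x hx.differentiableAt_fderiv.hasFDerivAt
  have h2 : HasDerivAt (fun τ : ℝ => fderiv ℝ f (x + τ • u) v) (fderiv ℝ (fderiv ℝ f) x u v) 0 :=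
    h1.hasLineDerivAt u
  refine h2.unique ((hx.hasDerivAt_pairDistDeriv u v).congr_of_eventuallyEq ?_)
  have hc : Filter.Tendsto (fun τ : ℝ => x + τ • u) (nhds 0) (nhds x) := by
    have : Continuous fun τ : ℝ => x + τ • u := by fun_prop
    simpa using this.tendsto 0
  filter_upwards [hc.eventually hx.eventually] with τ hτ
  exact hτ.fderiv_f v

/-! ### Enclosures over the box -/

section
open AffineForm
variable {x : Fin 7 → ℝ} (hx : x ∈ boxP)
include hx

lemma encloses_sinCoord (i : Fin 7) : Encloses (noise x) (sinCoord i) (Real.sin (x i)) := by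
  rw [eq_center_add_noise x i]
  exact encloses_sinForm (abs_noise_le hx) i (radius_pos i).le (radius_le_scale i)
    (abs_sin_center_sub_le i) (abs_cos_center_sub_le i)

lemma encloses_cosCoord (i : Fin 7) : Encloses (noise x) (cosCoord i) (Real.cos (x i)) := by
  rw [eq_center_add_noise x i]
  exact encloses_cosForm (abs_noise_le hx) i (radius_pos i).le (radius_le_scale i)
    (abs_sin_center_sub_le i) (abs_cos_center_sub_le i)

lemma encloses_sinLat (k : Fin 5) : Encloses (noise x) (sinLat k) (Real.sin (latVec x k)) := by
  fin_cases k
  · simpa [latVec, sinLat] using encloses_zero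
  all_goals exact encloses_sinCoord hx _

lemma encloses_cosLat (k : Fin 5) : Encloses (noise x) (cosLat k) (Real.cos (latVec x k)) := by
  fin_cases k
  · simpa [latVec, cosLat] using encloses_one
  all_goals exact encloses_cosCoord hx _

lemma encloses_sinLon (k : Fin 5) : Encloses (noise x) (sinLon k) (Real.sin (lonAng x k)) := by
  fin_cases k
  · simpa [lonAng, sinLon] using encloses_zero
  · simpa [lonAng, sinLon] using encloses_zero
  all_goals exact encloses_sinCoord hx _

lemma encloses_cosLon (k : Fin 5) : Encloses (noise x) (cosLon k) (Real.cos (lonAng x k)) := by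
  fin_cases k
  · simpa [lonAng, cosLon] using encloses_one
  · have h := encloses_const (δ := noise x) (-scale)
    rw [Int.cast_neg, neg_div, div_self scale_pos.ne'] at h
    simpa [lonAng, cosLon] using h
  all_goals exact encloses_cosCoord hx _

lemma encloses_cosDiff (k l : Fin 5) :
    Encloses (noise x) (cosDiff k l) (Real.cos (lonAng x k - lonAng x l)) := by
  have hδ := abs_noise_le hx
  rw [Real.cos_sub]
  exact ((encloses_cosLon hx k).mul hδ (encloses_cosLon hx l)).add
    ((encloses_sinLon hx k).mul hδ (encloses_sinLon hx l))

lemma encloses_sinDiff (k l : Fin 5) :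
    Encloses (noise x) (sinDiff k l) (Real.sin (lonAng x k - lonAng x l)) := by
  have hδ := abs_noise_le hx
  rw [Real.sin_sub]
  exact ((encloses_sinLon hx k).mul hδ (encloses_cosLon hx l)).sub
    ((encloses_cosLon hx k).mul hδ (encloses_sinLon hx l))

lemma encloses_cosCos (k l : Fin 5) :
    Encloses (noise x) (cosCos k l) (Real.cos (latVec x k) * Real.cos (latVec x l)) :=
  (encloses_cosLat hx k).mul (abs_noise_le hx) (encloses_cosLat hx l)

lemma encloses_inner (k l : Fin 5) :
    Encloses (noise x) (inner k l) (pairInner x (k, l)) :=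
  have hδ := abs_noise_le hx
  ((encloses_cosCos hx k l).mul hδ (encloses_cosDiff hx k l)).add
    ((encloses_sinLat hx k).mul hδ (encloses_sinLat hx l))

lemma encloses_sqDist (k l : Fin 5) :
    Encloses (noise x) (sqDist k l) (2 - 2 * pairInner x (k, l)) := by
  have h := encloses_const (δ := noise x) (2 * scale)
  have h2 := (encloses_inner hx k l).smul 2
  rw [Int.cast_mul, mul_div_cancel_right₀ _ scale_pos.ne'] at h
  exact_mod_cast h.sub h2

lemma separated_of_mem_boxP : Separated x := fun k hk =>
  (rsqrtValid_sqDist k hk).pos (abs_noise_le hx) (encloses_sqDist hx k.1 k.2)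

lemma encloses_invDist {k : Fin 5 × Fin 5} (hk : k ∈ pairs) :
    Encloses (noise x) (invDist k.1 k.2) (pairDist x k)⁻¹ :=
  (encloses_sqDist hx k.1 k.2).rsqrt (abs_noise_le hx) (rsqrtValid_sqDist k hk)

lemma encloses_innerDeriv (k l : Fin 5) (a₁ a₂ a₃ a₄ : ℤ) :
    Encloses (noise x) (innerDeriv k l a₁ a₂ a₃ a₄)
      (angInnerDeriv (latVec x k) (lonAng x k) (latVec x l) (lonAng x l) a₁ a₂ a₃ a₄) := by
  have hδ := abs_noise_le hx
  have hC := encloses_cosDiff hx k l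
  have hcs := (encloses_cosLat hx k).mul hδ (encloses_sinLat hx l)
  have hsc := (encloses_sinLat hx k).mul hδ (encloses_cosLat hx l)
  have hS := (encloses_cosCos hx k l).mul hδ (encloses_sinDiff hx k l)
  exact ((hcs.sub (hsc.mul hδ hC)).smul a₁).add ((hS.neg.smul a₂).add
    (((hsc.sub (hcs.mul hδ hC)).smul a₃).add (hS.smul a₄)))

lemma encloses_innerDeriv₂ (k l : Fin 5) (a₁ a₂ a₃ a₄ b₁ b₂ b₃ b₄ : ℤ) :
    Encloses (noise x) (innerDeriv₂ k l a₁ a₂ a₃ a₄ b₁ b₂ b₃ b₄)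
      (angInnerDeriv₂ (latVec x k) (lonAng x k) (latVec x l) (lonAng x l)
        a₁ a₂ a₃ a₄ b₁ b₂ b₃ b₄) := by
  have hδ := abs_noise_le hx
  have hC := encloses_cosDiff hx k l
  have hS := encloses_sinDiff hx k l
  have hsk := encloses_sinLat hx k
  have hsl := encloses_sinLat hx l
  have hcl := encloses_cosLat hx l
  have hck := encloses_cosLat hx k
  have hcc := encloses_cosCos hx k l
  have h₁₁ := (encloses_inner hx k l).neg
  have h₁₂ := (hsk.mul hδ hcl).mul hδ hS
  have h₁₃ := ((hsk.mul hδ hsl).mul hδ hC).add hcc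
  have h₂₂ := (hcc.mul hδ hC).neg
  have h₂₃ := (hck.mul hδ hsl).mul hδ hS
  have h₂₄ := hcc.mul hδ hC
  exact (((h₁₁.smul b₁).add ((h₁₂.smul b₂).add ((h₁₃.smul b₃).add (h₁₂.neg.smul b₄)))).smul
    a₁).add ((((h₁₂.smul b₁).add ((h₂₂.smul b₂).add ((h₂₃.smul b₃).add (h₂₄.smul b₄)))).smul
    a₂).add ((((h₁₃.smul b₁).add ((h₂₃.smul b₂).add ((h₁₁.smul b₃).add (h₂₃.neg.smul
    b₄)))).smul a₃).add (((h₁₂.neg.smul b₁).add ((h₂₄.smul b₂).add ((h₂₃.neg.smul b₃).add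
    (h₂₂.smul b₄)))).smul a₄)))

omit hx in
lemma latVec_single (i : Fin 7) (k : Fin 5) :
    latVec (Pi.single i (1 : ℝ)) k = (latVec (fun n => if n = i then 1 else 0) k : ℤ) := by
  fin_cases k <;> simp [latVec, Pi.single_apply]

omit hx in
lemma lonVec_single (i : Fin 7) (k : Fin 5) :
    lonVec (Pi.single i (1 : ℝ)) k = (lonVec (fun n => if n = i then 1 else 0) k : ℤ) := by
  fin_cases k <;> simp [lonVec, Pi.single_apply]

lemma encloses_distDeriv₂ (i j : Fin 7) {k : Fin 5 × Fin 5} (hk : k ∈ pairs) :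
    Encloses (noise x) (distDeriv₂ i j k)
      (pairDistDeriv₂ x (Pi.single i 1) (Pi.single j 1) k) := by
  have hδ := abs_noise_le hx
  have hw := encloses_invDist hx hk
  simp only [pairDistDeriv₂, latVec_single, lonVec_single]
  exact ((hw.mul hδ (encloses_innerDeriv₂ hx k.1 k.2 _ _ _ _ _ _ _ _)).add
    ((hw.mul hδ (hw.mul hδ hw)).mul hδ ((encloses_innerDeriv hx k.1 k.2 _ _ _ _).mul hδ
      (encloses_innerDeriv hx k.1 k.2 _ _ _ _)))).neg

lemma encloses_hessForm (i j : Fin 7) :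
    Encloses (noise x) (hessForm i j) (hessian f x i j) := by
  rw [hessian, Matrix.of_apply, (separated_of_mem_boxP hx).fderiv_fderiv_f]
  exact encloses_listSum pairs fun k hk => encloses_distDeriv₂ hx i j hk

lemma f_le_of_mem_boxP : f x ≤ 15.68 := by
  have hδ := abs_noise_le hx
  have h : Encloses (noise x) sumForm (f x) := by
    rw [f_eq]
    refine encloses_listSum pairs fun k hk => ?_
    have hpos : 0 < 2 - 2 * pairInner x k := separated_of_mem_boxP hx k hk
    have h1 := (encloses_sqDist hx k.1 k.2).mul hδ (encloses_invDist hx hk)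
    have h2 : (2 - 2 * pairInner x (k.1, k.2)) * (pairDist x k)⁻¹ = pairDist x k := by
      rw [pairDist, angDist, ← div_eq_mul_inv]
      exact Real.div_sqrt
    rwa [h2] at h1
  refine (h.le_upper hδ).trans ?_
  rw [div_le_iff₀ scale_pos]
  have h3 : (upper sumForm : ℝ) ≤ 156800000000000 := by exact_mod_cast upper_sumForm_le
  exact h3.trans (by norm_num [scale])

end

lemma hessLower_eq (i j : Fin 7) : hessLower i j = hessLowerInt i j / scale := by
  fin_cases i <;> fin_cases j <;> norm_num [hessLower, hessLowerInt, scale]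

lemma hessUpper_eq (i j : Fin 7) : hessUpper i j = hessUpperInt i j / scale := by
  fin_cases i <;> fin_cases j <;> norm_num [hessUpper, hessUpperInt, scale]

lemma isSymm_hessian {x : Fin 7 → ℝ} (hx : Separated x) : (hessian f x).IsSymm := by
  ext i j
  have h : IsSymmSndFDerivAt ℝ f x :=
    (hx.contDiffAt (n := 2)).isSymmSndFDerivAt (by simp)
  exact h.eq _ _

lemma hessian_mem {x : Fin 7 → ℝ} (hx : x ∈ boxP) :
    hessian f x ∈ symIntervalMatrix hessLower hessUpper := by
  have hS := AffineForm.scale_pos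
  have hδ := abs_noise_le hx
  refine ⟨isSymm_hessian (separated_of_mem_boxP hx), fun i j => ⟨?_, ?_⟩⟩
  · refine le_trans ?_ ((encloses_hessForm hx i j).lower_le hδ)
    rw [hessLower_eq]
    gcongr
    exact_mod_cast (AffineForm.hessForm_bounds i j).1
  · refine ((encloses_hessForm hx i j).le_upper hδ).trans ?_
    rw [hessUpper_eq]
    gcongr
    exact_mod_cast (AffineForm.hessForm_bounds i j).2

/-! ### Eigenvalues of the interval Hessian matrix -/

/-- The Rayleigh quotient is at most the largest eigenvalue. -/
lemma le_maxEigenvalue {n : ℕ} {A : Matrix (Fin n) (Fin n) ℝ} (hA : A.IsHermitian)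
    (v : Fin n → ℝ) : v ⬝ᵥ A *ᵥ v ≤ maxEigenvalue A * (v ⬝ᵥ v) := by
  have hB : (maxEigenvalue A • (1 : Matrix (Fin n) (Fin n) ℝ) - A).PosSemidef := by
    rw [Matrix.posSemidef_iff_isHermitian_and_spectrum_nonneg]
    refine ⟨(Matrix.isHermitian_one.smul (by simp [IsSelfAdjoint])).sub hA, ?_⟩
    have h1 := spectrum.singleton_sub_eq A (maxEigenvalue A)
    rw [Algebra.algebraMap_eq_smul_one] at h1
    rw [← h1]
    rintro _ ⟨_, rfl, l, hl, rfl⟩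
    exact sub_nonneg.2 (le_csSup A.finite_spectrum.bddAbove hl)
  have h := hB.dotProduct_mulVec_nonneg v
  simp only [star_trivial, Matrix.sub_mulVec, Matrix.smul_mulVec, Matrix.one_mulVec,
    dotProduct_sub, dotProduct_smul, smul_eq_mul] at h
  linarith

/-- A Collatz–Wielandt bound for matrices with nonnegative entries. -/
lemma maxEigenvalueModulus_le {n : ℕ} {A : Matrix (Fin n) (Fin n) ℝ} {w : Fin n → ℝ} {c : ℝ}
    (hA : ∀ i j, 0 ≤ A i j) (hw : ∀ i, 0 < w i) (hc : 0 ≤ c) (h : ∀ i, (A *ᵥ w) i ≤ c * w i) :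
    maxEigenvalueModulus A ≤ c := by
  refine Real.sSup_le ?_ hc
  rintro _ ⟨l, hl, rfl⟩
  rw [← Matrix.spectrum_toLin'] at hl
  obtain ⟨x, hx⟩ := (Module.End.hasEigenvalue_iff_mem_spectrum.2 hl).exists_hasEigenvector
  have hx1 : A *ᵥ x = l • x := by simpa using hx.apply_eq_smul
  have hne : (Finset.univ : Finset (Fin n)).Nonempty := by
    by_contra hn
    rw [Finset.not_nonempty_iff_eq_empty, Finset.univ_eq_empty_iff] at hn
    exact hx.2 (Subsingleton.elim _ _)
  -- an index at which `|x i| / w i` is maximal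
  obtain ⟨i, -, hi⟩ := Finset.exists_max_image Finset.univ (fun i => |x i| / w i) hne
  set t := |x i| / w i with ht
  have hxj : ∀ j, |x j| ≤ t * w j := fun j => (div_le_iff₀ (hw j)).1 (hi j (Finset.mem_univ j))
  have hxi : |x i| = t * w i := by rw [ht, div_mul_cancel₀ _ (hw i).ne']
  have ht0 : 0 < t := by
    by_contra hneg
    refine hx.2 (funext fun j => abs_eq_zero.1 (le_antisymm ((hxj j).trans ?_) (abs_nonneg _)))
    exact mul_nonpos_of_nonpos_of_nonneg (not_lt.1 hneg) (hw j).le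
  have h1 : |l| * (t * w i) ≤ c * (t * w i) := by
    calc |l| * (t * w i) = |(A *ᵥ x) i| := by rw [hx1, Pi.smul_apply, smul_eq_mul, abs_mul, hxi]
      _ ≤ ∑ j, |A i j * x j| :=
          Finset.abs_sum_le_sum_abs (fun j => A i j * x j) Finset.univ
      _ ≤ ∑ j, A i j * (t * w j) := Finset.sum_le_sum fun j _ => by
          rw [abs_mul, abs_of_nonneg (hA i j)]
          exact mul_le_mul_of_nonneg_left (hxj j) (hA i j)
      _ = t * (A *ᵥ w) i := by
          simp only [Matrix.mulVec, dotProduct, Finset.mul_sum]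
          exact Finset.sum_congr rfl fun j _ => by ring
      _ ≤ t * (c * w i) := mul_le_mul_of_nonneg_left (h i) ht0.le
      _ = _ := by ring
  exact le_of_mul_le_mul_right h1 (mul_pos ht0 (hw i))

/-- An approximate eigenvector for the largest eigenvalue of the midpoint matrix. -/
def ascentDirection : Fin 7 → ℤ := ![75363, 34258, 0, -39592, 2433, -39592, -2433]

/-- An approximate Perron eigenvector of the radius matrix. -/
def radiusWeight : Fin 7 → ℤ := ![45687, 44150, 19869, 40286, 34079, 40286, 34079]

lemma midMatrix_hess_apply (i j : Fin 7) : midMatrix hessLower hessUpper i j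
    = (hessLowerInt i j + hessUpperInt i j : ℤ) / (2 * scale) := by
  simp only [midMatrix, Matrix.smul_apply, Matrix.add_apply, hessLower_eq, hessUpper_eq,
    smul_eq_mul]
  push_cast
  field_simp

lemma radMatrix_hess_apply (i j : Fin 7) : radMatrix hessLower hessUpper i j
    = (hessUpperInt i j - hessLowerInt i j : ℤ) / (2 * scale) := by
  simp only [radMatrix, Matrix.smul_apply, Matrix.sub_apply, hessLower_eq, hessUpper_eq,
    smul_eq_mul]
  push_cast
  field_simp

/-- The constant `0.05656` separates the spectral radius of the radius matrix, about `0.05654`, from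
the largest eigenvalue of the midpoint matrix, about `0.05658`. -/
lemma lt_maxEigenvalue_mid : 0.05656 < maxEigenvalue (midMatrix hessLower hessUpper) := by
  have hS := AffineForm.scale_pos
  have hsymm : ∀ i j,
      hessLowerInt i j + hessUpperInt i j = hessLowerInt j i + hessUpperInt j i := by
    decide +kernel
  have hA : (midMatrix hessLower hessUpper).IsHermitian := by
    ext i j
    rw [Matrix.conjTranspose_apply, star_trivial, midMatrix_hess_apply, midMatrix_hess_apply,
      hsymm i j]
  have h := le_maxEigenvalue hA fun i => (ascentDirection i : ℝ)
  have h1 : (5656 * 2 * scale) * ∑ i, ascentDirection i * ascentDirection i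
      < 100000 * ∑ i, ∑ j, ascentDirection i *
        ((hessLowerInt i j + hessUpperInt i j) * ascentDirection j) := by
    decide +kernel
  have h1' : (5656 * 2 * scale : ℝ) * ∑ i, (ascentDirection i * ascentDirection i : ℝ)
      < 100000 * ∑ i, ∑ j, (ascentDirection i : ℝ) *
        ((hessLowerInt i j + hessUpperInt i j) * ascentDirection j) := by
    exact_mod_cast h1
  have h2 : 0 < ∑ i, ascentDirection i * ascentDirection i := by decide +kernel
  have h2' : 0 < ∑ i, (ascentDirection i * ascentDirection i : ℝ) := by exact_mod_cast h2
  have h3 : (2 * scale : ℝ) * ((fun i => (ascentDirection i : ℝ)) ⬝ᵥ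
      midMatrix hessLower hessUpper *ᵥ fun i => (ascentDirection i : ℝ))
      = ∑ i, ∑ j, (ascentDirection i : ℝ) *
        ((hessLowerInt i j + hessUpperInt i j) * ascentDirection j) := by
    simp only [dotProduct, Matrix.mulVec, midMatrix_hess_apply, Finset.mul_sum]
    refine Finset.sum_congr rfl fun i _ => Finset.sum_congr rfl fun j _ => ?_
    push_cast
    field_simp
  rw [← h3] at h1'
  simp only [dotProduct] at h h1'
  set q := ∑ i, (ascentDirection i * ascentDirection i : ℝ)
  by_contra hneg
  have h4 : maxEigenvalue (midMatrix hessLower hessUpper) * q ≤ 0.05656 * q :=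
    mul_le_mul_of_nonneg_right (not_lt.1 hneg) h2'.le
  have h5 := mul_le_mul_of_nonneg_left (h.trans h4) (by positivity : (0 : ℝ) ≤ 2 * scale)
  linarith

lemma maxEigenvalueModulus_rad_le :
    maxEigenvalueModulus (radMatrix hessLower hessUpper) ≤ 0.05656 := by
  have hS := AffineForm.scale_pos
  have h1 : ∀ i j, hessLowerInt i j ≤ hessUpperInt i j := by decide +kernel
  have h2 : ∀ i, 0 < radiusWeight i := by decide +kernel
  have h3 : ∀ i, 100000 * ∑ j, (hessUpperInt i j - hessLowerInt i j) * radiusWeight j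
      ≤ (5656 * 2 * scale) * radiusWeight i := by decide +kernel
  refine maxEigenvalueModulus_le (w := fun i => (radiusWeight i : ℝ)) (fun i j => ?_)
    (fun i => by exact_mod_cast h2 i) (by norm_num) fun i => ?_
  · rw [radMatrix_hess_apply]
    have : (0 : ℝ) ≤ (hessUpperInt i j - hessLowerInt i j : ℤ) := by
      exact_mod_cast sub_nonneg.2 (h1 i j)
    positivity
  · have h3' : (100000 : ℝ) * ∑ j, (hessUpperInt i j - hessLowerInt i j : ℝ) * radiusWeight j
        ≤ (5656 * 2 * scale) * radiusWeight i := by exact_mod_cast h3 i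
    have h4 : (radMatrix hessLower hessUpper *ᵥ fun i => (radiusWeight i : ℝ)) i
        = (∑ j, (hessUpperInt i j - hessLowerInt i j : ℝ) * radiusWeight j) / (2 * scale) := by
      simp only [dotProduct, Matrix.mulVec, radMatrix_hess_apply, Finset.sum_div]
      refine Finset.sum_congr rfl fun j _ => ?_
      push_cast
      field_simp
    rw [h4, div_le_iff₀ (by positivity)]
    linarith

/-- Every matrix between `hessLower` and `hessUpper` is positive along `ascentDirection`. -/
lemma dotProduct_mulVec_ascentDirection_pos {A : Matrix (Fin 7) (Fin 7) ℝ}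
    (hA : A ∈ symIntervalMatrix hessLower hessUpper) :
    0 < (fun i => (ascentDirection i : ℝ)) ⬝ᵥ A *ᵥ fun i => (ascentDirection i : ℝ) := by
  have hS := AffineForm.scale_pos
  have h1 : 0 < ∑ i, ∑ j, min (ascentDirection i * ascentDirection j * hessLowerInt i j)
      (ascentDirection i * ascentDirection j * hessUpperInt i j) := by decide +kernel
  have h1' : (0 : ℝ) < ∑ i, ∑ j, min (ascentDirection i * ascentDirection j * hessLowerInt i j : ℝ)
      (ascentDirection i * ascentDirection j * hessUpperInt i j) := by exact_mod_cast h1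
  have h2 : ∑ i, ∑ j, min (ascentDirection i * ascentDirection j * hessLowerInt i j : ℝ)
      (ascentDirection i * ascentDirection j * hessUpperInt i j)
      ≤ scale * ((fun i => (ascentDirection i : ℝ)) ⬝ᵥ A *ᵥ fun i => (ascentDirection i : ℝ)) := by
    simp only [dotProduct, Matrix.mulVec, Finset.mul_sum]
    refine Finset.sum_le_sum fun i _ => Finset.sum_le_sum fun j _ => ?_
    obtain ⟨hL, hU⟩ := hA.2 i j
    rw [hessLower_eq, div_le_iff₀ hS] at hL
    rw [hessUpper_eq, le_div_iff₀ hS] at hU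
    rw [show (scale : ℝ) * (ascentDirection i * (A i j * ascentDirection j))
      = ascentDirection i * ascentDirection j * (A i j * scale) by ring]
    rcases le_total 0 (ascentDirection i * ascentDirection j : ℝ) with h0 | h0
    · exact (min_le_left _ _).trans (mul_le_mul_of_nonneg_left hL h0)
    · exact (min_le_right _ _).trans (mul_le_mul_of_nonpos_left hU h0)
  exact pos_of_mul_pos_right (h1'.trans_le h2) hS.le

lemma not_posSemidef_neg {A : Matrix (Fin 7) (Fin 7) ℝ}
    (hA : A ∈ symIntervalMatrix hessLower hessUpper) : ¬ (-A).PosSemidef := by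
  intro h
  have h1 := h.dotProduct_mulVec_nonneg fun i => (ascentDirection i : ℝ)
  have h2 := dotProduct_mulVec_ascentDirection_pos hA
  simp only [star_trivial, Matrix.neg_mulVec, dotProduct_neg] at h1
  linarith

/-! ### The second derivative test -/

/-- A function with a positive second directional derivative has no local maximum. -/
lemma not_isLocalMax_of_fderiv_fderiv_pos {E : Type*} [NormedAddCommGroup E] [NormedSpace ℝ E]
    {g : E → ℝ} {x v : E} (hg : ContDiffAt ℝ 2 g x)
    (hv : 0 < fderiv ℝ (fderiv ℝ g) x v v) : ¬ IsLocalMax g x := by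
  intro hmax
  have hc : Filter.Tendsto (fun τ : ℝ => x + τ • v) (nhds 0) (nhds x) := by
    have : Continuous fun τ : ℝ => x + τ • v := by fun_prop
    simpa using this.tendsto 0
  have hline : ∀ τ : ℝ, HasDerivAt (fun τ : ℝ => x + τ • v) v τ := fun τ => by
    simpa using ((hasDerivAt_id τ).smul_const v).const_add x
  set φ : ℝ → ℝ := fun τ => g (x + τ • v) with hφ
  have hd1 : ∀ᶠ τ in nhds (0 : ℝ), deriv φ τ = fderiv ℝ g (x + τ • v) v := by
    have := hg.eventually (by simp)
    filter_upwards [hc.eventually this] with τ hτ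
    exact ((hτ.differentiableAt two_ne_zero).hasFDerivAt.comp_hasDerivAt τ (hline τ)).deriv
  have hd2 : deriv (deriv φ) 0 = fderiv ℝ (fderiv ℝ g) x v v := by
    rw [Filter.EventuallyEq.deriv_eq hd1]
    have hdd : DifferentiableAt ℝ (fderiv ℝ g) x :=
      (hg.fderiv_right (m := 1) (by norm_num)).differentiableAt one_ne_zero
    have h1 : HasFDerivAt (fun y => fderiv ℝ g y v)
        ((ContinuousLinearMap.apply ℝ ℝ v).comp (fderiv ℝ (fderiv ℝ g) x)) x :=
      (ContinuousLinearMap.apply ℝ ℝ v).hasFDerivAt.comp x hdd.hasFDerivAt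
    exact HasDerivAt.deriv (h1.hasLineDerivAt v)
  have hφmax : IsLocalMax φ 0 := by
    have := hc.eventually hmax
    simpa [IsLocalMax, IsMaxFilter, hφ] using this
  have hφc : ContinuousAt φ 0 := by
    have h1 : ContinuousAt g (x + (0 : ℝ) • v) := by simpa using hg.continuousAt
    exact h1.comp (f := fun τ : ℝ => x + τ • v) (by fun_prop)
  have hφmin := isLocalMin_of_deriv_deriv_pos (hd2 ▸ hv) hφmax.deriv_eq_zero hφc
  -- a local minimum and maximum: constant near `0`
  have hconst : φ =ᶠ[nhds 0] fun _ => φ 0 := by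
    filter_upwards [hφmin, hφmax] with τ h1 h2 using le_antisymm h2 h1
  have h0 : deriv (deriv φ) 0 = 0 := by
    rw [hconst.deriv.deriv_eq]
    simp
  linarith

lemma dotProduct_hessian_mulVec (g : (Fin 7 → ℝ) → ℝ) (x v : Fin 7 → ℝ) :
    v ⬝ᵥ hessian g x *ᵥ v = fderiv ℝ (fderiv ℝ g) x v v := by
  conv_rhs => rw [pi_eq_sum_univ' v]
  simp only [map_sum, map_smul, _root_.sum_apply, _root_.smul_apply,
    smul_eq_mul, dotProduct, Matrix.mulVec, hessian, Matrix.of_apply, Finset.mul_sum]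
  rw [Finset.sum_comm]
  refine Finset.sum_congr rfl fun i _ => Finset.sum_congr rfl fun j _ => ?_
  ring

lemma not_isLocalMax_of_mem_boxP {x : Fin 7 → ℝ} (hx : x ∈ boxP) : ¬ IsLocalMax f x := by
  refine not_isLocalMax_of_fderiv_fderiv_pos (v := fun i => (ascentDirection i : ℝ))
    (separated_of_mem_boxP hx).contDiffAt ?_
  rw [← dotProduct_hessian_mulVec]
  exact dotProduct_mulVec_ascentDirection_pos (hessian_mem hx)

/-! ### The bipyramid -/

lemma fmax_eq : fmax = 3 * √3 + 6 * √2 + 2 := by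
  have h4 : √(4 : ℝ) = 2 := by
    rw [show (4 : ℝ) = 2 ^ 2 by norm_num]; exact Real.sqrt_sq (by norm_num)
  have h3 : √3 * √3 = (3 : ℝ) := Real.mul_self_sqrt (by norm_num)
  have d : ∀ k ∈ pairs, ∀ a : ℝ, 2 - 2 * pairInner thetaBP k = a → pairDist thetaBP k = √a := by
    rintro k - a rfl; rfl
  rw [fmax, f_eq]
  simp only [pairs, List.map_cons, List.map_nil, List.sum_cons, List.sum_nil]
  rw [d (0, 1) (by decide) 3, d (0, 2) (by decide) 3, d (0, 3) (by decide) 2,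
    d (0, 4) (by decide) 2,
    d (1, 2) (by decide) 3, d (1, 3) (by decide) 2, d (1, 4) (by decide) 2, d (2, 3) (by decide) 2,
    d (2, 4) (by decide) 2, d (3, 4) (by decide) 4, h4]
  · ring
  all_goals
    simp [pairInner, angInner, thetaBP, latVec, lonAng, Real.cos_sub, Real.cos_add]
    try nlinarith [h3]

/-! ### Sine and cosine of the angles of the square pyramid -/

/-- The cosine of `omega1`. -/
noncomputable def cosOmega1 : ℝ := √(1 - sinOmega1 ^ 2)

/-- The cosine of `omega2`. -/
noncomputable def cosOmega2 : ℝ := √(1 - (sinOmega1 * cosOmega1) ^ 2)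

lemma sqrt_two_mem : √2 ∈ Set.Icc (1.41421356237309504880 : ℝ) 1.41421356237309504881 :=
  ⟨Real.le_sqrt_of_sq_le (by norm_num), Real.sqrt_le_iff.2 ⟨by norm_num, by norm_num⟩⟩

lemma sinOmega1_mem : sinOmega1 ∈ Set.Icc (0.253124121636534785 : ℝ) 0.253124121636534787 := by
  obtain ⟨h1, h2⟩ := sqrt_two_mem
  have h3 : (1.184069361799949045 : ℝ) ≤ √(41 - 28 * √2) :=
    Real.le_sqrt_of_sq_le (by linarith)
  have h4 : √(41 - 28 * √2) ≤ (1.184069361799949047 : ℝ) :=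
    Real.sqrt_le_iff.2 ⟨by norm_num, by linarith⟩
  unfold sinOmega1
  constructor <;> linarith

lemma sinOmega1_pos : 0 < sinOmega1 := lt_of_lt_of_le (by norm_num) sinOmega1_mem.1

/-- The quadratic equation that makes the square pyramid critical. -/
lemma sinOmega1_eq : 2 * (3 + 2 * √2) * sinOmega1 ^ 2 + sinOmega1 - 1 = 0 := by
  have h1 : √2 * √2 = (2 : ℝ) := Real.mul_self_sqrt (by norm_num)
  have h2 : √(41 - 28 * √2) * √(41 - 28 * √2) = 41 - 28 * √2 :=
    Real.mul_self_sqrt (by linarith [sqrt_two_mem.2])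
  unfold sinOmega1
  set r := √2
  set w := √(41 - 28 * r)
  linear_combination ((3 + 2 * r) / 8) * h2 + (-17 / 2 + r + w) * h1

lemma cosOmega1_sq : cosOmega1 ^ 2 = 1 - sinOmega1 ^ 2 :=
  Real.sq_sqrt (by nlinarith [sinOmega1_mem.1, sinOmega1_mem.2])

lemma cosOmega1_mem : cosOmega1 ∈ Set.Icc (0.967433811196266150 : ℝ) 0.967433811196266153 := by
  obtain ⟨h1, h2⟩ := sinOmega1_mem
  exact ⟨Real.le_sqrt_of_sq_le (by nlinarith), Real.sqrt_le_iff.2 ⟨by norm_num, by nlinarith⟩⟩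

lemma cosOmega1_pos : 0 < cosOmega1 := lt_of_lt_of_le (by norm_num) cosOmega1_mem.1

lemma sin_mul_cos_omega1_mem :
    sinOmega1 * cosOmega1 ∈ Set.Icc (0.244880833700540100 : ℝ) 0.244880833700540104 := by
  obtain ⟨h1, h2⟩ := sinOmega1_mem
  obtain ⟨h3, h4⟩ := cosOmega1_mem
  have hs := sinOmega1_pos
  constructor
  · refine le_trans ?_ (mul_le_mul h1 h3 (by norm_num) hs.le)
    norm_num
  · refine (mul_le_mul h2 h4 cosOmega1_pos.le (by norm_num)).trans ?_
    norm_num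

lemma cosOmega2_sq : cosOmega2 ^ 2 = 1 - (sinOmega1 * cosOmega1) ^ 2 :=
  Real.sq_sqrt (by nlinarith [sin_mul_cos_omega1_mem.1, sin_mul_cos_omega1_mem.2])

lemma cosOmega2_mem : cosOmega2 ∈ Set.Icc (0.969553184351497251 : ℝ) 0.969553184351497259 := by
  obtain ⟨h1, h2⟩ := sin_mul_cos_omega1_mem
  exact ⟨Real.le_sqrt_of_sq_le (by nlinarith), Real.sqrt_le_iff.2 ⟨by norm_num, by nlinarith⟩⟩

lemma cosOmega2_pos : 0 < cosOmega2 := lt_of_lt_of_le (by norm_num) cosOmega2_mem.1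

lemma sin_omega1 : Real.sin omega1 = sinOmega1 :=
  Real.sin_arcsin (by linarith [sinOmega1_pos]) (by linarith [sinOmega1_mem.2])

lemma cos_omega1 : Real.cos omega1 = cosOmega1 := Real.cos_arcsin _

lemma omega2_eq : omega2 = -Real.arcsin (sinOmega1 * cosOmega1) := rfl

lemma sin_omega2 : Real.sin omega2 = -(sinOmega1 * cosOmega1) := by
  obtain ⟨h1, h2⟩ := sin_mul_cos_omega1_mem
  rw [omega2_eq, Real.sin_neg, Real.sin_arcsin (by linarith) (by linarith)]

lemma cos_omega2 : Real.cos omega2 = cosOmega2 := by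
  rw [omega2_eq, Real.cos_neg, Real.cos_arcsin, cosOmega2]

lemma sqrt_one_add_cot_sq :
    √(1 + (sinOmega1 ^ 2 / cosOmega1) ^ 2) = cosOmega2 / cosOmega1 := by
  have hc := cosOmega1_pos
  have hk := cosOmega2_pos
  rw [← Real.sqrt_sq (div_pos hk hc).le, div_pow, div_pow, cosOmega2_sq]
  congr 1
  field_simp
  linear_combination (1 + sinOmega1 ^ 2) * cosOmega1_sq

lemma omega3_eq : omega3 = Real.pi / 2 - Real.arcsin (sinOmega1 ^ 2 / cosOmega2) := by
  have hc := cosOmega1_pos.ne'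
  have hk := cosOmega2_pos.ne'
  rw [omega3, arccot, Real.arctan_eq_arcsin]
  change Real.pi / 2 - Real.arcsin (sinOmega1 ^ 2 / cosOmega1
    / √(1 + (sinOmega1 ^ 2 / cosOmega1) ^ 2)) = _
  rw [sqrt_one_add_cot_sq]
  congr 2
  field_simp

lemma sin_omega3 : Real.sin omega3 = cosOmega1 / cosOmega2 := by
  have hc := cosOmega1_pos.ne'
  rw [omega3, arccot, Real.sin_pi_div_two_sub, Real.cos_arctan]
  change 1 / √(1 + (sinOmega1 ^ 2 / cosOmega1) ^ 2) = _
  rw [sqrt_one_add_cot_sq, one_div_div]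

lemma sq_sin_div_cos_omega2_mem :
    sinOmega1 ^ 2 / cosOmega2 ∈ Set.Icc (0.06608386418443130 : ℝ) 0.06608386418443136 := by
  obtain ⟨h1, h2⟩ := sinOmega1_mem
  obtain ⟨h3, h4⟩ := cosOmega2_mem
  have hk := cosOmega2_pos
  constructor
  · rw [le_div_iff₀ hk]; nlinarith
  · rw [div_le_iff₀ hk]; nlinarith

lemma cos_omega3 : Real.cos omega3 = sinOmega1 ^ 2 / cosOmega2 := by
  obtain ⟨h1, h2⟩ := sq_sin_div_cos_omega2_mem
  rw [omega3_eq, Real.cos_pi_div_two_sub, Real.sin_arcsin (by linarith) (by linarith)]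

/-! ### Location of the pyramid point -/

/-- An enclosure of an arcsine from Taylor bounds at the endpoints: the hypotheses give
`sin a ≤ u` and `v ≤ sin b`. -/
lemma arcsin_mem_of_sum {y a b u v e : ℝ} (n : ℕ) (ha : a ∈ Set.Icc 0 1) (hb : b ∈ Set.Icc 0 1)
    (hn : 1 ≤ n) (hy : y ∈ Set.Icc u v)
    (hu : |∑ k ∈ Finset.range n, (-1) ^ k * a ^ (2 * k + 1) / (2 * k + 1).factorial - (u - e)|
      + |a| ^ (2 * n) / (2 * n).factorial * 2 ≤ e)
    (hv : |∑ k ∈ Finset.range n, (-1) ^ k * b ^ (2 * k + 1) / (2 * k + 1).factorial - (v + e)|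
      + |b| ^ (2 * n) / (2 * n).factorial * 2 ≤ e) : Real.arcsin y ∈ Set.Icc a b := by
  have hn' : (1 : ℝ) ≤ n := by exact_mod_cast hn
  have hpi := Real.pi_gt_three
  have h1 := abs_le.1 (abs_sin_sub_le_of_sum a (u - e) e n
    (by rw [abs_of_nonneg ha.1]; linarith [ha.2]) hu)
  have h2 := abs_le.1 (abs_sin_sub_le_of_sum b (v + e) e n
    (by rw [abs_of_nonneg hb.1]; linarith [hb.2]) hv)
  constructor
  · rw [Real.le_arcsin_iff_sin_le' ⟨by linarith [ha.1], by linarith [ha.2]⟩]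
    linarith [hy.1]
  · rw [Real.arcsin_le_iff_le_sin' ⟨by linarith [hb.1], by linarith [hb.2]⟩]
    linarith [hy.2]

lemma omega1_mem : omega1 ∈ Set.Icc (0.255908184853 : ℝ) 0.255908184855 := by
  refine arcsin_mem_of_sum (e := 1 / 10 ^ 12) 9 ?_ ?_ (by norm_num) sinOmega1_mem ?_ ?_ <;>
    norm_num [Finset.sum_range_succ, Nat.factorial, abs_le, abs_of_pos]

lemma arcsin_sin_mul_cos_mem :
    Real.arcsin (sinOmega1 * cosOmega1) ∈ Set.Icc (0.2473967821537 : ℝ) 0.2473967821557 := by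
  refine arcsin_mem_of_sum (e := 1 / 10 ^ 12) 9 ?_ ?_ (by norm_num) sin_mul_cos_omega1_mem
    ?_ ?_ <;>
    norm_num [Finset.sum_range_succ, Nat.factorial, abs_le, abs_of_pos]

lemma arcsin_sq_sin_div_mem :
    Real.arcsin (sinOmega1 ^ 2 / cosOmega2) ∈ Set.Icc (0.0661320578414 : ℝ) 0.0661320578434 := by
  refine arcsin_mem_of_sum (e := 1 / 10 ^ 12) 9 ?_ ?_ (by norm_num) sq_sin_div_cos_omega2_mem
    ?_ ?_ <;>
    norm_num [Finset.sum_range_succ, Nat.factorial, abs_le, abs_of_pos]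

lemma boxLower_mem_thetaP (i : Fin 7) :
    thetaP i - (Real.pi / 791 + 1 / 10 ^ 8) ≤ boxLower i ∧
      boxLower i ≤ thetaP i - Real.pi / 791 := by
  obtain ⟨h1, h2⟩ := omega1_mem
  obtain ⟨h3, h4⟩ := arcsin_sin_mul_cos_mem
  obtain ⟨h5, h6⟩ := arcsin_sq_sin_div_mem
  have h7 := Real.pi_gt_d20
  have h8 := Real.pi_lt_d20
  fin_cases i <;> simp [thetaP, boxLower, omega2_eq, omega3_eq] <;> constructor <;> linarith

lemma boxUpper_mem_thetaP (i : Fin 7) :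
    thetaP i + Real.pi / 791 ≤ boxUpper i ∧
      boxUpper i ≤ thetaP i + (Real.pi / 791 + 1 / 10 ^ 8) := by
  obtain ⟨h1, h2⟩ := omega1_mem
  obtain ⟨h3, h4⟩ := arcsin_sin_mul_cos_mem
  obtain ⟨h5, h6⟩ := arcsin_sq_sin_div_mem
  have h7 := Real.pi_gt_d20
  have h8 := Real.pi_lt_d20
  fin_cases i <;> simp [thetaP, boxUpper, omega2_eq, omega3_eq] <;> constructor <;> linarith

lemma closedBall_subset_boxP : Metric.closedBall thetaP (Real.pi / 791) ⊆ boxP := by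
  intro x hx
  have h := (dist_pi_le_iff (by positivity)).1 (Metric.mem_closedBall.1 hx)
  refine ⟨fun i => ?_, fun i => ?_⟩ <;> have hi := abs_le.1 (h i)
  · linarith [(boxLower_mem_thetaP i).2]
  · linarith [(boxUpper_mem_thetaP i).1]

lemma boxP_subset_closedBall :
    boxP ⊆ Metric.closedBall thetaP (Real.pi / 791 + 1 / 10 ^ 8) := by
  intro x hx
  refine Metric.mem_closedBall.2 ((dist_pi_le_iff (by positivity)).2 fun i => abs_le.2 ⟨?_, ?_⟩)
  · linarith [(boxLower_mem_thetaP i).1, hx.1 i]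
  · linarith [(boxUpper_mem_thetaP i).2, hx.2 i]

lemma thetaP_mem_boxP : thetaP ∈ boxP :=
  closedBall_subset_boxP (Metric.mem_closedBall_self (by positivity))

/-! ### The pyramid point is critical -/

lemma latVec_thetaP : latVec thetaP = ![0, -(2 * omega1), Real.pi / 2 - omega1, omega2, omega2] := by
  ext k; fin_cases k <;> simp [latVec, thetaP]

lemma lonAng_thetaP : lonAng thetaP = ![0, Real.pi, Real.pi, -omega3, omega3] := by
  ext k; fin_cases k <;> simp [lonAng, thetaP]

lemma sin_lat_one : Real.sin (-(2 * omega1)) = -(2 * sinOmega1 * cosOmega1) := by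
  rw [Real.sin_neg, Real.sin_two_mul, sin_omega1, cos_omega1]

lemma cos_lat_one : Real.cos (-(2 * omega1)) = 1 - 2 * sinOmega1 ^ 2 := by
  rw [Real.cos_neg, Real.cos_two_mul, cos_omega1, cosOmega1_sq]; ring

lemma sin_latVec_thetaP (k : Fin 5) : Real.sin (latVec thetaP k) =
    (![0, -(2 * sinOmega1 * cosOmega1), cosOmega1, -(sinOmega1 * cosOmega1),
      -(sinOmega1 * cosOmega1)] : Fin 5 → ℝ) k := by
  rw [latVec_thetaP]
  fin_cases k
  · exact Real.sin_zero
  · exact sin_lat_one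
  · exact (Real.sin_pi_div_two_sub _).trans cos_omega1
  · exact sin_omega2
  · exact sin_omega2

lemma cos_latVec_thetaP (k : Fin 5) : Real.cos (latVec thetaP k) =
    (![1, 1 - 2 * sinOmega1 ^ 2, sinOmega1, cosOmega2, cosOmega2] : Fin 5 → ℝ) k := by
  rw [latVec_thetaP]
  fin_cases k
  · exact Real.cos_zero
  · exact cos_lat_one
  · exact (Real.cos_pi_div_two_sub _).trans sin_omega1
  · exact cos_omega2
  · exact cos_omega2

lemma sin_lonAng_thetaP (k : Fin 5) : Real.sin (lonAng thetaP k) =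
    (![0, 0, 0, -(cosOmega1 / cosOmega2), cosOmega1 / cosOmega2] : Fin 5 → ℝ) k := by
  rw [lonAng_thetaP]
  fin_cases k
  · exact Real.sin_zero
  · exact Real.sin_pi
  · exact Real.sin_pi
  · exact (Real.sin_neg _).trans (by rw [sin_omega3]; rfl)
  · exact sin_omega3

lemma cos_lonAng_thetaP (k : Fin 5) : Real.cos (lonAng thetaP k) =
    (![1, -1, -1, sinOmega1 ^ 2 / cosOmega2, sinOmega1 ^ 2 / cosOmega2] : Fin 5 → ℝ) k := by
  rw [lonAng_thetaP]
  fin_cases k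
  · exact Real.cos_zero
  · exact Real.cos_pi
  · exact Real.cos_pi
  · exact (Real.cos_neg _).trans cos_omega3
  · exact cos_omega3

/-- The relations of `cosOmega2` with `cos omega3` and `sin omega3`, written as fractions. -/
lemma sin_cos_omega3_relations :
    cosOmega2 * (sinOmega1 ^ 2 / cosOmega2) = sinOmega1 ^ 2 ∧
    cosOmega2 * (cosOmega1 / cosOmega2) = cosOmega1 ∧
    cosOmega2 = sinOmega1 ^ 2 * (sinOmega1 ^ 2 / cosOmega2)
      + cosOmega1 * (cosOmega1 / cosOmega2) := by
  have hk := cosOmega2_pos.ne'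
  refine ⟨mul_div_cancel₀ _ hk, mul_div_cancel₀ _ hk, ?_⟩
  field_simp
  linear_combination cosOmega2_sq - (1 + sinOmega1 ^ 2) * cosOmega1_sq

/-- The squared distances of the pyramid: diagonals of the base, edges of the base, and edges at
the apex, which is the point with index `2`. -/
lemma sqDist_thetaP :
    2 - 2 * pairInner thetaP (0, 1) = (2 * cosOmega1) ^ 2 ∧
    2 - 2 * pairInner thetaP (0, 2) = 2 + 2 * sinOmega1 ∧
    2 - 2 * pairInner thetaP (0, 3) = 2 * cosOmega1 ^ 2 ∧
    2 - 2 * pairInner thetaP (0, 4) = 2 * cosOmega1 ^ 2 ∧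
    2 - 2 * pairInner thetaP (1, 2) = 2 + 2 * sinOmega1 ∧
    2 - 2 * pairInner thetaP (1, 3) = 2 * cosOmega1 ^ 2 ∧
    2 - 2 * pairInner thetaP (1, 4) = 2 * cosOmega1 ^ 2 ∧
    2 - 2 * pairInner thetaP (2, 3) = 2 + 2 * sinOmega1 ∧
    2 - 2 * pairInner thetaP (2, 4) = 2 + 2 * sinOmega1 ∧
    2 - 2 * pairInner thetaP (3, 4) = (2 * cosOmega1) ^ 2 := by
  obtain ⟨e3, e4, -⟩ := sin_cos_omega3_relations
  have e1 := cosOmega1_sq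
  simp only [pairInner, angInner, Real.cos_sub, sin_latVec_thetaP, cos_latVec_thetaP,
    sin_lonAng_thetaP, cos_lonAng_thetaP, Matrix.cons_val]
  set s := sinOmega1
  set c := cosOmega1
  set k := cosOmega2
  set C := s ^ 2 / k
  set S := c / k
  refine ⟨?_, ?_, ?_, ?_, ?_, ?_, ?_, ?_, ?_, ?_⟩
  · linear_combination (-4) * e1
  · ring
  · linear_combination (-2) * e3 - 2 * e1
  · linear_combination (-2) * e3 - 2 * e1
  · linear_combination 4 * s * e1
  · linear_combination 2 * (1 - 2 * s ^ 2) * e3 - (4 * s ^ 2 + 2) * e1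
  · linear_combination 2 * (1 - 2 * s ^ 2) * e3 - (4 * s ^ 2 + 2) * e1
  · linear_combination 2 * s * e3 + 2 * s * e1
  · linear_combination 2 * s * e3 + 2 * s * e1
  · linear_combination (-2) * (k * C + s ^ 2) * e3 + 2 * (k * S + c) * e4 - (2 + 2 * s ^ 2) * e1

lemma sqrt_two_add_two_mul_sinOmega1 :
    √(2 + 2 * sinOmega1) = cosOmega1 / ((1 + √2) * sinOmega1) := by
  have hs := sinOmega1_pos
  have hc := cosOmega1_pos
  have h2 : √2 ^ 2 = (2 : ℝ) := Real.sq_sqrt (by norm_num)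
  rw [← Real.sqrt_sq (by positivity : 0 ≤ cosOmega1 / ((1 + √2) * sinOmega1)), div_pow, mul_pow,
    cosOmega1_sq]
  congr 1
  rw [eq_div_iff (by positivity)]
  linear_combination (1 + sinOmega1) * sinOmega1_eq + 2 * (1 + sinOmega1) * sinOmega1 ^ 2 * h2

/-- The lengths of the edges and diagonals; the last form of the length of the edges at the apex
comes from the equation for `sinOmega1`. -/
lemma pairDist_thetaP :
    pairDist thetaP (0, 1) = 2 * cosOmega1 ∧
    pairDist thetaP (0, 2) = cosOmega1 / ((1 + √2) * sinOmega1) ∧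
    pairDist thetaP (0, 3) = √2 * cosOmega1 ∧
    pairDist thetaP (0, 4) = √2 * cosOmega1 ∧
    pairDist thetaP (1, 2) = cosOmega1 / ((1 + √2) * sinOmega1) ∧
    pairDist thetaP (1, 3) = √2 * cosOmega1 ∧
    pairDist thetaP (1, 4) = √2 * cosOmega1 ∧
    pairDist thetaP (2, 3) = cosOmega1 / ((1 + √2) * sinOmega1) ∧
    pairDist thetaP (2, 4) = cosOmega1 / ((1 + √2) * sinOmega1) ∧
    pairDist thetaP (3, 4) = 2 * cosOmega1 := by
  have hc := cosOmega1_pos.le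
  have hside : √(2 * cosOmega1 ^ 2) = √2 * cosOmega1 := by
    rw [Real.sqrt_mul (by norm_num), Real.sqrt_sq hc]
  have hdiag : √((2 * cosOmega1) ^ 2) = 2 * cosOmega1 := Real.sqrt_sq (by positivity)
  have d : ∀ k, ∀ a : ℝ, 2 - 2 * pairInner thetaP k = a → pairDist thetaP k = √a := by
    rintro k - rfl; rfl
  obtain ⟨h0, h1, h2, h3, h4, h5, h6, h7, h8, h9⟩ := sqDist_thetaP
  rw [d _ _ h0, d _ _ h1, d _ _ h2, d _ _ h3, d _ _ h4, d _ _ h5, d _ _ h6, d _ _ h7, d _ _ h8,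
    d _ _ h9, hside, hdiag, sqrt_two_add_two_mul_sinOmega1]
  simp

lemma f_thetaP : f thetaP
    = 4 * cosOmega1 + 4 * √2 * cosOmega1 + 4 * (cosOmega1 / ((1 + √2) * sinOmega1)) := by
  obtain ⟨h0, h1, h2, h3, h4, h5, h6, h7, h8, h9⟩ := pairDist_thetaP
  rw [f_eq]
  simp only [pairs, List.map_cons, List.map_nil, List.sum_cons, List.sum_nil, h0, h1, h2, h3, h4,
    h5, h6, h7, h8, h9]
  ring

lemma abs_f_thetaP_sub_le : |f thetaP - 15.67482117| ≤ 1 / 10 ^ 8 := by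
  obtain ⟨h1, h2⟩ := sqrt_two_mem
  obtain ⟨h3, h4⟩ := sinOmega1_mem
  obtain ⟨h5, h6⟩ := cosOmega1_mem
  have hr : √2 * cosOmega1 ∈ Set.Icc (1.3681580164 : ℝ) 1.3681580165 := by
    constructor
    · refine le_trans ?_ (mul_le_mul h1 h5 (by norm_num) (by positivity))
      norm_num
    · refine (mul_le_mul h2 h6 cosOmega1_pos.le (by norm_num)).trans ?_
      norm_num
  have ha : √(2 + 2 * sinOmega1) ∈ Set.Icc (1.5831134650 : ℝ) 1.5831134651 :=
    ⟨Real.le_sqrt_of_sq_le (by linarith), Real.sqrt_le_iff.2 ⟨by norm_num, by linarith⟩⟩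
  rw [sqrt_two_add_two_mul_sinOmega1] at ha
  rw [f_thetaP, abs_le]
  constructor <;> linarith [hr.1, hr.2, ha.1, ha.2]

lemma fderiv_f_thetaP : fderiv ℝ f thetaP = 0 := by
  ext u
  rw [(separated_of_mem_boxP thetaP_mem_boxP).fderiv_f, _root_.zero_apply]
  obtain ⟨h0, h1, h2, h3, h4, h5, h6, h7, h8, h9⟩ := pairDist_thetaP
  obtain ⟨e3, e4, e5⟩ := sin_cos_omega3_relations
  have hs := sinOmega1_pos.ne'
  have hc := cosOmega1_pos.ne'
  have hr : √2 ^ 2 = (2 : ℝ) := Real.sq_sqrt (by norm_num)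
  have hr0 : √2 ≠ (0 : ℝ) := by positivity
  -- all reciprocal distances are multiples of that of the diagonals
  have w1 : (√2 * cosOmega1)⁻¹ = √2 * (2 * cosOmega1)⁻¹ := by
    field_simp
    linear_combination -hr
  have w2 : (cosOmega1 / ((1 + √2) * sinOmega1))⁻¹
      = 2 * (1 + √2) * sinOmega1 * (2 * cosOmega1)⁻¹ := by
    field_simp
  simp only [pairDist] at h0 h1 h2 h3 h4 h5 h6 h7 h8 h9
  simp only [pairs, List.map_cons, List.map_nil, List.sum_cons, List.sum_nil, pairDistDeriv,
    angDistDeriv, h0, h1, h2, h3, h4, h5, h6, h7, h8, h9, w1, w2]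
  simp only [angInnerDeriv, Real.cos_sub, Real.sin_sub, sin_latVec_thetaP, cos_latVec_thetaP,
    sin_lonAng_thetaP, cos_lonAng_thetaP, Matrix.cons_val]
  simp only [latVec, lonVec, Matrix.cons_val]
  set s := sinOmega1
  set c := cosOmega1
  set k := cosOmega2
  set r := √2
  generalize s ^ 2 / k = C at *
  generalize c / k = S at *
  -- the components along `u 0`, …, `u 6` vanish separately
  linear_combination (-(2 * c)⁻¹) * ((-4 * r * s * c * u 0 + 4 * (1 + r) * s * c * u 1
      + 2 * k * S * (u 4 - u 6) + s * c * C * (u 3 + u 5)) * e3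
    - s * c * S * (u 3 + u 5) * e4 + s * c * (u 3 + u 5) * e5)

/-! ### Comparison with the bipyramid -/

lemma f_lt_fmax {x : Fin 7 → ℝ} (hx : x ∈ boxP) : f x < fmax := by
  have h3 : (1.732 : ℝ) ≤ √3 := Real.le_sqrt_of_sq_le (by norm_num)
  rw [fmax_eq]
  linarith [f_le_of_mem_boxP hx, sqrt_two_mem.1]

end FivePoints

theorem mainTheorem3 :
    -- the value at the bipyramid point
    FivePoints.fmax = 3 * √3 + 6 * √2 + 2 ∧
    -- the box is the cube of radius `π / 791` around the pyramid point, with slightly enlarged sides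
    Metric.closedBall FivePoints.thetaP (Real.pi / 791) ⊆ FivePoints.boxP ∧
    FivePoints.boxP ⊆ Metric.closedBall FivePoints.thetaP (Real.pi / 791 + 1 / 10 ^ 8) ∧
    -- smoothness on the box, so that the derivatives below are genuine
    (∀ x ∈ FivePoints.boxP, ContDiffAt ℝ 2 FivePoints.f x) ∧
    -- the pyramid point is stationary, with the stated value
    fderiv ℝ FivePoints.f FivePoints.thetaP = 0 ∧
    |FivePoints.f FivePoints.thetaP - 15.67482117| ≤ 1 / 10 ^ 8 ∧
    -- the Hessian matrix over the box varies in the symmetric interval matrix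
    (∀ x ∈ FivePoints.boxP, FivePoints.hessian FivePoints.f x ∈
      FivePoints.symIntervalMatrix FivePoints.hessLower FivePoints.hessUpper) ∧
    -- the eigenvalue bound
    FivePoints.maxEigenvalueModulus
        (FivePoints.radMatrix FivePoints.hessLower FivePoints.hessUpper) <
      FivePoints.maxEigenvalue
        (FivePoints.midMatrix FivePoints.hessLower FivePoints.hessUpper) ∧
    -- no member of the interval matrix is negative semidefinite
    (∀ A ∈ FivePoints.symIntervalMatrix FivePoints.hessLower FivePoints.hessUpper,
      ¬ (-A).PosSemidef) ∧
    -- no maximum in the box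
    (∀ x ∈ FivePoints.boxP, ¬ IsLocalMax FivePoints.f x) ∧
    (∀ x ∈ FivePoints.boxP, FivePoints.f x < FivePoints.fmax) := by

  exact ⟨FivePoints.fmax_eq, FivePoints.closedBall_subset_boxP,
    FivePoints.boxP_subset_closedBall,
    fun x hx => (FivePoints.separated_of_mem_boxP hx).contDiffAt,
    FivePoints.fderiv_f_thetaP, FivePoints.abs_f_thetaP_sub_le,
    fun x hx => FivePoints.hessian_mem hx,
    FivePoints.maxEigenvalueModulus_rad_le.trans_lt FivePoints.lt_maxEigenvalue_mid,
    fun A hA => FivePoints.not_posSemidef_neg hA,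
    fun x hx => FivePoints.not_isLocalMax_of_mem_boxP hx, fun x hx => FivePoints.f_lt_fmax hx⟩
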